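/- **Proposition 3.5.** Let $\mathscr{B}\subseteq\mathscr{A}$ be an inclusion of unital complex $*$-algebras such that the C*-enveloping algebra $B$ of $\mathscr{B}$ exists, with canonical $*$-homomorphism $\iota:\mathscr{B}\to B$. Let $\mathrm{Vect}_{\mathscr{A}}(\mathscr{B})$ be the set of isomorphism classes of $\mathscr{B}$-bimodules $\mathscr{E}$ that are finitely generated and projective as right $\mathscr{B}$-modules and *trivialize over $\mathscr{A}$*: there are an integer $r\ge 0$ and an isomorphism $\mathscr{E}\otimes_{\mathscr{B}}\mathscr{A}\cong\mathscr{A}^r$ of $\mathscr{B}$-$\mathscr{A}$-bimodules, where both algebras act componentwise on $\mathscr{A}^r$. With $\oplus$ and $\otimes_{\mathscr{B}}$ this set is a unital semiring, with unit $\mathscr{B}$. For an idempotent $p\in M_N(\mathscr{B})$ let $\mathrm{Tr}\,p=\sum_i p_i^i\in\mathscr{B}$, and let $[p]\in K_0(B)$ be the class of the idempotent $\iota(p)\in M_N(B)$. Assume that there are a character (unital $*$-homomorphism) $\varepsilon:\mathscr{A}\to\mathbb{C}$ and a unital $*$-representation $\pi:\mathscr{A}\to\mathcal{B}(\mathcal{H})$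 by bounded operators on a Hilbert space $\mathcal{H}$ such that $\pi(b)-\varepsilon(b)$ is of trace class for all $b\in\mathscr{B}$. Then: 1. There is a homomorphism of unital semirings $$\mathrm{ch}=\mathrm{ch}_0+\mathrm{ch}_1t:\big(\mathrm{Vect}_{\mathscr{A}}(\mathscr{B}),\oplus,\otimes_{\mathscr{B}}\big)\to\mathbb{Z}[t]/(t^2)$$ given, whenever $p\in M_N(\mathscr{B})$ is an idempotent with $\mathscr{E}\cong p\,\mathscr{B}^N$ as right $\mathscr{B}$-modules, by $$\mathrm{ch}_0(\mathscr{E})=\varepsilon(\mathrm{Tr}\,p),\qquad \mathrm{ch}_1(\mathscr{E})=\mathrm{Tr}_{\mathcal{H}}\big(\pi(\mathrm{Tr}\,p)-\varepsilon(\mathrm{Tr}\,p)\big).$$ 2. There is a homomorphism of abelian groups $[\mathrm{ch}]:K_0(B)\to\mathbb{Z}[t]/(t^2)$ such that $\mathrm{ch}(\mathscr{E})=[\mathrm{ch}]([p])$ whenever $\mathscr{E}\cong p\,\mathscr{B}^N$ as above. Moreover, for every idempotent $p\in M_N(\mathscr{B})$ one has $$[\mathrm{ch}]([p])=\varepsilon(\mathrm{Tr}\,p)+\mathrm{Tr}_{\mathcal{H}}\big(\pi(\mathrm{Tr}\,p)-\varepsilon(\mathrm{Tr}\,p)\big)\,t.$$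 3. Let $(u,v)$ be a trivializing pair for $\mathscr{E}\in\mathrm{Vect}_{\mathscr{A}}(\mathscr{B})$. This means: $u$ is an $N\times r$ matrix and $v$ an $r\times N$ matrix over $\mathscr{A}$ with $vu=1$ and $uv\in M_N(\mathscr{B})$, and for some isomorphism of right $\mathscr{A}$-modules $\Theta:\mathscr{E}\otimes_{\mathscr{B}}\mathscr{A}\to\mathscr{A}^r$ and some right $\mathscr{B}$-linear maps $\psi:\mathscr{E}\to\mathscr{B}^N$ and $\xi:\mathscr{B}^N\to\mathscr{E}$ with $\xi\circ\psi=\mathrm{Id}_{\mathscr{E}}$ one has $\psi(e)=u\,\Theta(e\otimes 1)$ for $e\in\mathscr{E}$ and $\Theta(\xi(b)\otimes 1)=v\,b$ for $b\in\mathscr{B}^N$. Then the number $r$ of columns of $u$ is equal to $\mathrm{ch}_0(\mathscr{E})$. -/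

import Mathlib

open MulOpposite

universe u v w

noncomputable section

namespace NCBundle

/-! ## Bimodules and the tensor product over a noncommutative ring

A right `S`-module is a `Module Sᵐᵒᵖ M`; an `(R, S)`-bimodule is a left `R`-module and a right
`S`-module with commuting actions. -/

section Tensor

/-- The subgroup of `M ⊗_ℤ N` generated by the elements `m s ⊗ n - m ⊗ s n`. -/
def balancedRel (S M N : Type*) [Ring S] [AddCommGroup M] [Module Sᵐᵒᵖ M]
    [AddCommGroup N] [Module S N] : AddSubgroup (TensorProduct ℤ M N) :=
  AddSubgroup.closure {x | ∃ (m : M) (s : S) (n : N),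
    x = TensorProduct.tmul ℤ (op s • m) n - TensorProduct.tmul ℤ m (s • n)}

/-- The tensor product `M ⊗_S N` of a right `S`-module `M` and a left `S`-module `N`. -/
def BalTensor (S M N : Type*) [Ring S] [AddCommGroup M] [Module Sᵐᵒᵖ M]
    [AddCommGroup N] [Module S N] : Type _ :=
  TensorProduct ℤ M N ⧸ balancedRel S M N

instance (S M N : Type*) [Ring S] [AddCommGroup M] [Module Sᵐᵒᵖ M]
    [AddCommGroup N] [Module S N] : AddCommGroup (BalTensor S M N) :=
  inferInstanceAs (AddCommGroup (TensorProduct ℤ M N ⧸ balancedRel S M N))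

namespace BalTensor

section Basic

variable {S M N P : Type*} [Ring S] [AddCommGroup M] [Module Sᵐᵒᵖ M]
  [AddCommGroup N] [Module S N] [AddCommGroup P]

/-- The class of `m ⊗ n` in `M ⊗_S N`. -/
def tmul (S : Type*) {M N : Type*} [Ring S] [AddCommGroup M] [Module Sᵐᵒᵖ M]
    [AddCommGroup N] [Module S N] (m : M) (n : N) : BalTensor S M N :=
  QuotientAddGroup.mk' (balancedRel S M N) (TensorProduct.tmul ℤ m n)

theorem tmul_add (m : M) (n n' : N) : tmul S m (n + n') = tmul S m n + tmul S m n' := by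
  simp only [tmul, TensorProduct.tmul_add]
  exact map_add (QuotientAddGroup.mk' (balancedRel S M N)) _ _

theorem add_tmul (m m' : M) (n : N) : tmul S (m + m') n = tmul S m n + tmul S m' n := by
  simp only [tmul, TensorProduct.add_tmul]
  exact map_add (QuotientAddGroup.mk' (balancedRel S M N)) _ _

theorem smul_tmul (s : S) (m : M) (n : N) : tmul S (op s • m) n = tmul S m (s • n) := by
  have h : TensorProduct.tmul ℤ (op s • m) n - TensorProduct.tmul ℤ m (s • n) ∈
      balancedRel S M N := AddSubgroup.subset_closure ⟨m, s, n, rfl⟩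
  have h2 := (QuotientAddGroup.eq_zero_iff _).2 h
  rw [QuotientAddGroup.mk_sub] at h2
  exact sub_eq_zero.1 h2

theorem tmul_zero (m : M) : tmul S m (0 : N) = 0 := by
  have h := tmul_add (S := S) m (0 : N) 0
  rw [add_zero] at h
  exact left_eq_add.1 h

theorem zero_tmul (n : N) : tmul S (0 : M) n = 0 := by
  have h := add_tmul (S := S) (0 : M) 0 n
  rw [add_zero] at h
  exact left_eq_add.1 h

theorem tmul_sum {J : Type*} (s : Finset J) (m : M) (f : J → N) :
    tmul S m (∑ j ∈ s, f j) = ∑ j ∈ s, tmul S m (f j) :=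
  map_sum (AddMonoidHom.mk' (fun n => tmul S m n) (tmul_add m)) f s

theorem sum_tmul {J : Type*} (s : Finset J) (f : J → M) (n : N) :
    tmul S (∑ j ∈ s, f j) n = ∑ j ∈ s, tmul S (f j) n :=
  map_sum (AddMonoidHom.mk' (fun m => tmul S m n) (fun a b => add_tmul a b n)) f s

theorem induction {p : BalTensor S M N → Prop} (ht : ∀ m n, p (tmul S m n))
    (ha : ∀ x y, p x → p y → p (x + y)) (x : BalTensor S M N) : p x := by
  obtain ⟨y, rfl⟩ := QuotientAddGroup.mk'_surjective (balancedRel S M N) x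
  induction y using TensorProduct.induction_on with
  | zero =>
    have h := ht 0 0
    rw [tmul_zero] at h
    exact h
  | tmul m n => exact ht m n
  | add a b h1 h2 => rw [map_add]; exact ha _ _ h1 h2

/-- The universal property of `M ⊗_S N`: biadditive balanced maps. -/
def lift (f : M → N → P) (h1 : ∀ m m' n, f (m + m') n = f m n + f m' n)
    (h2 : ∀ m n n', f m (n + n') = f m n + f m n')
    (h3 : ∀ (s : S) m n, f (op s • m) n = f m (s • n)) : BalTensor S M N →+ P :=
  QuotientAddGroup.lift (balancedRel S M N)
    (TensorProduct.liftAddHom (R := ℤ)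
      (AddMonoidHom.mk' (fun m => AddMonoidHom.mk' (f m) (h2 m))
        (fun a b => AddMonoidHom.ext fun n => h1 a b n))
      (fun r m n => by
        rw [map_zsmul, map_zsmul]; rfl))
    ((AddSubgroup.closure_le _).2 (by
      rintro _ ⟨m, s, n, rfl⟩
      exact (map_sub _ _ _).trans (sub_eq_zero.2 (h3 s m n))))

theorem lift_tmul (f : M → N → P) (h1 h2 h3) (m : M) (n : N) :
    lift (S := S) f h1 h2 h3 (tmul S m n) = f m n := rfl

end Basic

section Actions

variable {R S T M N : Type*} [Ring R] [Ring S] [Ring T]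
  [AddCommGroup M] [Module R M] [Module Sᵐᵒᵖ M] [SMulCommClass R Sᵐᵒᵖ M]
  [AddCommGroup N] [Module S N] [Module Tᵐᵒᵖ N] [SMulCommClass S Tᵐᵒᵖ N]

/-- The left action `r (m ⊗ n) = (r m) ⊗ n`. -/
instance instLeftModule (R S M N : Type*) [Ring R] [Ring S]
    [AddCommGroup M] [Module R M] [Module Sᵐᵒᵖ M] [SMulCommClass R Sᵐᵒᵖ M]
    [AddCommGroup N] [Module S N] : Module R (BalTensor S M N) where
  smul r := lift (fun m n => tmul S (r • m) n)
    (fun m m' n => by rw [smul_add, add_tmul]) (fun m n n' => tmul_add _ _ _)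
    (fun s m n => by rw [smul_comm, smul_tmul])
  one_smul x := by
    induction x using induction with
    | ht m n => exact congrArg (fun z => tmul S z n) (one_smul R m)
    | ha x y hx hy => exact (map_add _ _ _).trans (congrArg₂ _ hx hy)
  mul_smul a b x := by
    induction x using induction with
    | ht m n => exact congrArg (fun z => tmul S z n) (mul_smul a b m)
    | ha x y hx hy =>
      refine (map_add _ _ _).trans ((congrArg₂ _ hx hy).trans ?_)
      exact ((congrArg _ (map_add _ _ _)).trans (map_add _ _ _)).symm
  smul_zero a := map_zero _
  smul_add a x y := map_add _ _ _
  add_smul a b x := by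
    induction x using induction with
    | ht m n => exact (congrArg (fun z => tmul S z n) (add_smul a b m)).trans (add_tmul _ _ _)
    | ha x y hx hy =>
      refine (map_add _ _ _).trans ((congrArg₂ _ hx hy).trans ?_)
      refine (add_add_add_comm _ _ _ _).trans ?_
      exact congrArg₂ _ (map_add _ _ _).symm (map_add _ _ _).symm
  zero_smul x := by
    induction x using induction with
    | ht m n => exact (congrArg (fun z => tmul S z n) (zero_smul R m)).trans (zero_tmul _)
    | ha x y hx hy =>
      refine (map_add _ _ _).trans ((congrArg₂ _ hx hy).trans ?_)
      exact add_zero _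

/-- The right action `(m ⊗ n) t = m ⊗ (n t)`. -/
instance instRightModule (S T M N : Type*) [Ring S] [Ring T]
    [AddCommGroup M] [Module Sᵐᵒᵖ M]
    [AddCommGroup N] [Module S N] [Module Tᵐᵒᵖ N] [SMulCommClass S Tᵐᵒᵖ N] :
    Module Tᵐᵒᵖ (BalTensor S M N) where
  smul t := lift (fun m n => tmul S m (t • n))
    (fun m m' n => add_tmul _ _ _) (fun m n n' => by rw [smul_add, tmul_add])
    (fun s m n => by rw [smul_tmul, smul_comm])
  one_smul x := by
    induction x using induction with
    | ht m n => exact congrArg (tmul S m) (one_smul _ n)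
    | ha x y hx hy => exact (map_add _ _ _).trans (congrArg₂ _ hx hy)
  mul_smul a b x := by
    induction x using induction with
    | ht m n => exact congrArg (tmul S m) (mul_smul a b n)
    | ha x y hx hy =>
      refine (map_add _ _ _).trans ((congrArg₂ _ hx hy).trans ?_)
      exact ((congrArg _ (map_add _ _ _)).trans (map_add _ _ _)).symm
  smul_zero a := map_zero _
  smul_add a x y := map_add _ _ _
  add_smul a b x := by
    induction x using induction with
    | ht m n => exact (congrArg (tmul S m) (add_smul a b n)).trans (tmul_add _ _ _)
    | ha x y hx hy =>
      refine (map_add _ _ _).trans ((congrArg₂ _ hx hy).trans ?_)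
      refine (add_add_add_comm _ _ _ _).trans ?_
      exact congrArg₂ _ (map_add _ _ _).symm (map_add _ _ _).symm
  zero_smul x := by
    induction x using induction with
    | ht m n => exact (congrArg (tmul S m) (zero_smul _ n)).trans (tmul_zero _)
    | ha x y hx hy =>
      refine (map_add _ _ _).trans ((congrArg₂ _ hx hy).trans ?_)
      exact add_zero _

theorem lsmul_tmul (r : R) (m : M) (n : N) : r • tmul S m n = tmul S (r • m) n := rfl

theorem rsmul_tmul (t : Tᵐᵒᵖ) (m : M) (n : N) : t • tmul S m n = tmul S m (t • n) := rfl

instance instSMulCommClass (R S T M N : Type*) [Ring R] [Ring S] [Ring T]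
    [AddCommGroup M] [Module R M] [Module Sᵐᵒᵖ M] [SMulCommClass R Sᵐᵒᵖ M]
    [AddCommGroup N] [Module S N] [Module Tᵐᵒᵖ N] [SMulCommClass S Tᵐᵒᵖ N] :
    SMulCommClass R Tᵐᵒᵖ (BalTensor S M N) where
  smul_comm r t x := by
    induction x using induction with
    | ht m n => rfl
    | ha x y hx hy => rw [smul_add, smul_add, smul_add, smul_add, hx, hy]

end Actions

end BalTensor

end Tensor

/-! ## Isomorphisms of bimodules -/

section Iso

/-- Isomorphisms of `(R, S)`-bimodules. -/
structure BimodIso (R S M N : Type*) [Ring R] [Ring S] [AddCommGroup M] [Module R M]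
    [Module Sᵐᵒᵖ M] [AddCommGroup N] [Module R N] [Module Sᵐᵒᵖ N] extends M ≃+ N where
  map_left : ∀ (r : R) (m : M), toFun (r • m) = r • toFun m
  map_right : ∀ (s : Sᵐᵒᵖ) (m : M), toFun (s • m) = s • toFun m

namespace BimodIso

variable {R S T U : Type*} [Ring R] [Ring S] [Ring T] [Ring U]

section Basic

variable {M N P M' N' : Type*}
  [AddCommGroup M] [Module R M] [Module Sᵐᵒᵖ M]
  [AddCommGroup N] [Module R N] [Module Sᵐᵒᵖ N]
  [AddCommGroup P] [Module R P] [Module Sᵐᵒᵖ P]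
  [AddCommGroup M'] [Module R M'] [Module Sᵐᵒᵖ M']
  [AddCommGroup N'] [Module R N'] [Module Sᵐᵒᵖ N']

def refl (R S M : Type*) [Ring R] [Ring S] [AddCommGroup M] [Module R M]
    [Module Sᵐᵒᵖ M] : BimodIso R S M M :=
  { AddEquiv.refl M with map_left := fun _ _ => rfl, map_right := fun _ _ => rfl }

def symm (e : BimodIso R S M N) : BimodIso R S N M :=
  { e.toAddEquiv.symm with
    map_left := fun r n => e.toAddEquiv.injective (by
      have h := e.map_left r (e.toAddEquiv.symm n)
      exact (e.toAddEquiv.apply_symm_apply _).trans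
        ((congrArg (r • ·) (e.toAddEquiv.apply_symm_apply n)).symm.trans h.symm))
    map_right := fun r n => e.toAddEquiv.injective (by
      have h := e.map_right r (e.toAddEquiv.symm n)
      exact (e.toAddEquiv.apply_symm_apply _).trans
        ((congrArg (r • ·) (e.toAddEquiv.apply_symm_apply n)).symm.trans h.symm)) }

def trans (e : BimodIso R S M N) (f : BimodIso R S N P) : BimodIso R S M P :=
  { e.toAddEquiv.trans f.toAddEquiv with
    map_left := fun r m => (congrArg f.toFun (e.map_left r m)).trans (f.map_left _ _)
    map_right := fun r m => (congrArg f.toFun (e.map_right r m)).trans (f.map_right _ _) }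

/-- The underlying isomorphism of right modules. -/
def toRight (e : BimodIso R S M N) : M ≃ₗ[Sᵐᵒᵖ] N :=
  { e.toAddEquiv with map_smul' := e.map_right }

def prodCongr (e : BimodIso R S M M') (f : BimodIso R S N N') :
    BimodIso R S (M × N) (M' × N') :=
  { AddEquiv.prodCongr e.toAddEquiv f.toAddEquiv with
    map_left := fun r x => Prod.ext (e.map_left r x.1) (f.map_left r x.2)
    map_right := fun r x => Prod.ext (e.map_right r x.1) (f.map_right r x.2) }

def prodComm (R S M N : Type*) [Ring R] [Ring S] [AddCommGroup M] [Module R M]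
    [Module Sᵐᵒᵖ M] [AddCommGroup N] [Module R N] [Module Sᵐᵒᵖ N] :
    BimodIso R S (M × N) (N × M) :=
  { AddEquiv.prodComm with map_left := fun _ _ => rfl, map_right := fun _ _ => rfl }

def prodAssoc (R S M N P : Type*) [Ring R] [Ring S] [AddCommGroup M] [Module R M]
    [Module Sᵐᵒᵖ M] [AddCommGroup N] [Module R N] [Module Sᵐᵒᵖ N]
    [AddCommGroup P] [Module R P] [Module Sᵐᵒᵖ P] :
    BimodIso R S ((M × N) × P) (M × (N × P)) :=
  { AddEquiv.prodAssoc with map_left := fun _ _ => rfl, map_right := fun _ _ => rfl }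

def unitProd (R S M : Type*) [Ring R] [Ring S] [AddCommGroup M] [Module R M]
    [Module Sᵐᵒᵖ M] : BimodIso R S (PUnit.{u + 1} × M) M :=
  { AddEquiv.uniqueProd with map_left := fun _ _ => rfl, map_right := fun _ _ => rfl }

def piCongr (J : Type*) (e : BimodIso R S M N) : BimodIso R S (J → M) (J → N) :=
  { AddEquiv.piCongrRight (fun _ : J => e.toAddEquiv) with
    map_left := fun r x => funext fun j => e.map_left r (x j)
    map_right := fun r x => funext fun j => e.map_right r (x j) }

def piReindex (R S M : Type*) [Ring R] [Ring S] [AddCommGroup M] [Module R M]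
    [Module Sᵐᵒᵖ M] {J K : Type*} (e : J ≃ K) : BimodIso R S (J → M) (K → M) :=
  { Equiv.arrowCongr e (Equiv.refl M) with
    map_add' := fun _ _ => rfl
    map_left := fun _ _ => rfl
    map_right := fun _ _ => rfl }

def piCurry (R S M J K : Type*) [Ring R] [Ring S] [AddCommGroup M] [Module R M]
    [Module Sᵐᵒᵖ M] : BimodIso R S (J → K → M) (J × K → M) :=
  { (Equiv.curry J K M).symm with
    map_add' := fun _ _ => rfl
    map_left := fun _ _ => rfl
    map_right := fun _ _ => rfl }

def piSum (R S M J K : Type*) [Ring R] [Ring S] [AddCommGroup M] [Module R M]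
    [Module Sᵐᵒᵖ M] : BimodIso R S ((J → M) × (K → M)) (J ⊕ K → M) :=
  { (Equiv.sumArrowEquivProdArrow J K M).symm with
    map_add' := fun x y => by ext (j | k) <;> rfl
    map_left := fun r x => by ext (j | k) <;> rfl
    map_right := fun r x => by ext (j | k) <;> rfl }

def piUnique (R S M J : Type*) [Ring R] [Ring S] [AddCommGroup M] [Module R M]
    [Module Sᵐᵒᵖ M] [Unique J] : BimodIso R S M (J → M) :=
  { (Equiv.funUnique J M).symm with
    map_add' := fun _ _ => rfl
    map_left := fun _ _ => rfl
    map_right := fun _ _ => rfl }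

def ofSubsingleton (R S M N : Type*) [Ring R] [Ring S] [AddCommGroup M] [Module R M]
    [Module Sᵐᵒᵖ M] [AddCommGroup N] [Module R N] [Module Sᵐᵒᵖ N]
    [Subsingleton M] [Subsingleton N] : BimodIso R S M N where
  toFun _ := 0
  invFun _ := 0
  left_inv _ := Subsingleton.elim _ _
  right_inv _ := Subsingleton.elim _ _
  map_add' _ _ := Subsingleton.elim _ _
  map_left _ _ := Subsingleton.elim _ _
  map_right _ _ := Subsingleton.elim _ _

end Basic

section Tensor

open BalTensor

/-- An isomorphism out of a tensor product from mutually inverse additive maps; linearity is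
checked on elementary tensors. -/
def ofTensor {M N P : Type*} [AddCommGroup M] [Module R M] [Module Sᵐᵒᵖ M]
    [SMulCommClass R Sᵐᵒᵖ M] [AddCommGroup N] [Module S N] [Module Tᵐᵒᵖ N]
    [SMulCommClass S Tᵐᵒᵖ N] [AddCommGroup P] [Module R P] [Module Tᵐᵒᵖ P]
    (f : BalTensor S M N →+ P) (g : P → BalTensor S M N)
    (hgadd : ∀ x y, g (x + y) = g x + g y)
    (hgf : ∀ m n, g (f (tmul S m n)) = tmul S m n) (hfg : ∀ x, f (g x) = x)
    (hl : ∀ (r : R) m n, f (tmul S (r • m) n) = r • f (tmul S m n))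
    (hr : ∀ (t : Tᵐᵒᵖ) m n, f (tmul S m (t • n)) = t • f (tmul S m n)) :
    BimodIso R T (BalTensor S M N) P where
  toFun := f
  invFun := g
  left_inv x := by
    induction x using BalTensor.induction with
    | ht m n => exact hgf m n
    | ha x y hx hy => rw [map_add, hgadd, hx, hy]
  right_inv := hfg
  map_add' := map_add f
  map_left r x := by
    induction x using BalTensor.induction with
    | ht m n => exact hl r m n
    | ha x y hx hy => rw [smul_add, map_add, hx, hy, map_add, smul_add]
  map_right r x := by
    induction x using BalTensor.induction with
    | ht m n => exact hr r m n
    | ha x y hx hy => rw [smul_add, map_add, hx, hy, map_add, smul_add]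

variable {M N P M' N' : Type*}
  [AddCommGroup M] [Module R M] [Module Sᵐᵒᵖ M] [SMulCommClass R Sᵐᵒᵖ M]
  [AddCommGroup M'] [Module R M'] [Module Sᵐᵒᵖ M'] [SMulCommClass R Sᵐᵒᵖ M']
  [AddCommGroup N] [Module S N] [Module Tᵐᵒᵖ N] [SMulCommClass S Tᵐᵒᵖ N]
  [AddCommGroup N'] [Module S N'] [Module Tᵐᵒᵖ N'] [SMulCommClass S Tᵐᵒᵖ N']
  [AddCommGroup P] [Module T P] [Module Uᵐᵒᵖ P] [SMulCommClass T Uᵐᵒᵖ P]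

/-- `f ⊗ g` for bimodule isomorphisms, as an additive map. -/
def tensorMap (e : BimodIso R S M M') (f : BimodIso S T N N') :
    BalTensor S M N →+ BalTensor S M' N' :=
  BalTensor.lift (fun m n => tmul S (e.toFun m) (f.toFun n))
    (fun m m' n => by rw [e.map_add', add_tmul])
    (fun m n n' => by rw [f.map_add', tmul_add])
    (fun s m n => by rw [e.map_right, f.map_left, BalTensor.smul_tmul])

def tensorCongr (e : BimodIso R S M M') (f : BimodIso S T N N') :
    BimodIso R T (BalTensor S M N) (BalTensor S M' N') :=
  ofTensor (tensorMap e f) (tensorMap e.symm f.symm) (map_add _)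
    (fun m n => congrArg₂ (tmul S) (e.left_inv m) (f.left_inv n))
    (fun x => by
      induction x using BalTensor.induction with
      | ht m n => exact congrArg₂ (tmul S) (e.right_inv m) (f.right_inv n)
      | ha x y hx hy => rw [map_add, map_add, hx, hy])
    (fun r m n => congrArg (fun z => tmul S z (f.toFun n)) (e.map_left r m))
    (fun r m n => congrArg (tmul S (e.toFun m)) (f.map_right r n))

section Assoc

variable (S T) (M N P : Type*) [AddCommGroup M] [Module Sᵐᵒᵖ M]
  [AddCommGroup N] [Module S N] [Module Tᵐᵒᵖ N] [SMulCommClass S Tᵐᵒᵖ N]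
  [AddCommGroup P] [Module T P]

def assocFwdAux (p : P) : BalTensor S M N →+ BalTensor S M (BalTensor T N P) :=
  BalTensor.lift (fun m n => tmul S m (tmul T n p))
    (fun _ _ _ => add_tmul _ _ _)
    (fun m n n' => by rw [add_tmul, tmul_add])
    (fun s m n => by rw [BalTensor.smul_tmul]; rfl)

def assocFwd : BalTensor T (BalTensor S M N) P →+ BalTensor S M (BalTensor T N P) :=
  BalTensor.lift (fun x p => assocFwdAux S T M N P p x)
    (fun _ _ _ => map_add _ _ _)
    (fun x p p' => by
      induction x using BalTensor.induction with
      | ht m n => exact (congrArg (tmul S m) (tmul_add n p p')).trans (tmul_add _ _ _)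
      | ha x y hx hy =>
        rw [map_add, map_add, map_add, hx, hy]; exact add_add_add_comm _ _ _ _)
    (fun t x p => by
      induction x using BalTensor.induction with
      | ht m n => exact congrArg (tmul S m) (BalTensor.smul_tmul t n p)
      | ha x y hx hy => rw [smul_add, map_add, map_add, hx, hy])

def assocBwdAux (m : M) : BalTensor T N P →+ BalTensor T (BalTensor S M N) P :=
  BalTensor.lift (fun n p => tmul T (tmul S m n) p)
    (fun n n' p => by rw [tmul_add, add_tmul])
    (fun _ _ _ => tmul_add _ _ _)
    (fun s n p => by rw [← BalTensor.smul_tmul]; rfl)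

def assocBwd : BalTensor S M (BalTensor T N P) →+ BalTensor T (BalTensor S M N) P :=
  BalTensor.lift (fun m x => assocBwdAux S T M N P m x)
    (fun m m' x => by
      induction x using BalTensor.induction with
      | ht n p =>
        exact (congrArg (fun z => tmul T z p) (add_tmul m m' n)).trans (add_tmul _ _ _)
      | ha x y hx hy =>
        rw [map_add, map_add, map_add, hx, hy]; exact add_add_add_comm _ _ _ _)
    (fun _ _ _ => map_add _ _ _)
    (fun s m x => by
      induction x using BalTensor.induction with
      | ht n p => exact congrArg (fun z => tmul T z p) (BalTensor.smul_tmul s m n)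
      | ha x y hx hy => rw [smul_add, map_add, map_add, hx, hy])

theorem assocFwd_tmul (m : M) (n : N) (p : P) :
    assocFwd S T M N P (tmul T (tmul S m n) p) = tmul S m (tmul T n p) := rfl

theorem assocBwd_tmul (m : M) (n : N) (p : P) :
    assocBwd S T M N P (tmul S m (tmul T n p)) = tmul T (tmul S m n) p := rfl

end Assoc

def tensorAssoc (R S T U M N P : Type*) [Ring R] [Ring S] [Ring T] [Ring U]
    [AddCommGroup M] [Module R M] [Module Sᵐᵒᵖ M] [SMulCommClass R Sᵐᵒᵖ M]
    [AddCommGroup N] [Module S N] [Module Tᵐᵒᵖ N] [SMulCommClass S Tᵐᵒᵖ N]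
    [AddCommGroup P] [Module T P] [Module Uᵐᵒᵖ P] [SMulCommClass T Uᵐᵒᵖ P] :
    BimodIso R U (BalTensor T (BalTensor S M N) P) (BalTensor S M (BalTensor T N P)) :=
  ofTensor (assocFwd S T M N P) (assocBwd S T M N P) (map_add _)
    (fun x p => by
      induction x using BalTensor.induction with
      | ht m n => rw [assocFwd_tmul, assocBwd_tmul]
      | ha x y hx hy => rw [add_tmul, map_add, map_add, hx, hy])
    (fun x => by
      induction x using BalTensor.induction with
      | ht m x =>
        induction x using BalTensor.induction with
        | ht n p => rw [assocBwd_tmul, assocFwd_tmul]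
        | ha x y hx hy => rw [tmul_add, map_add, map_add, hx, hy]
      | ha x y hx hy => rw [map_add, map_add, hx, hy])
    (fun r x p => by
      induction x using BalTensor.induction with
      | ht m n => rw [lsmul_tmul, assocFwd_tmul, assocFwd_tmul, lsmul_tmul]
      | ha x y hx hy => rw [smul_add, add_tmul, map_add, hx, hy, add_tmul, map_add, smul_add])
    (fun r x p => by
      induction x using BalTensor.induction with
      | ht m n => rw [assocFwd_tmul, assocFwd_tmul, rsmul_tmul, rsmul_tmul]
      | ha x y hx hy => rw [add_tmul, map_add, hx, hy, add_tmul, map_add, smul_add])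

def tensorLid (S T N : Type*) [Ring S] [Ring T] [AddCommGroup N] [Module S N]
    [Module Tᵐᵒᵖ N] [SMulCommClass S Tᵐᵒᵖ N] : BimodIso S T (BalTensor S S N) N :=
  ofTensor
    (BalTensor.lift (fun (s : S) (n : N) => s • n) (fun a b n => add_smul a b n)
      (fun a n n' => smul_add a n n') (fun s a n => by rw [op_smul_eq_mul, mul_smul]))
    (fun n => tmul S (1 : S) n) (fun _ _ => tmul_add _ _ _)
    (fun s n => by
      rw [lift_tmul, ← BalTensor.smul_tmul, op_smul_eq_mul, one_mul])
    (fun n => one_smul S n)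
    (fun r m n => mul_smul r m n)
    (fun t m n => smul_comm m t n)

def tensorRid (R S M : Type*) [Ring R] [Ring S] [AddCommGroup M] [Module R M]
    [Module Sᵐᵒᵖ M] [SMulCommClass R Sᵐᵒᵖ M] : BimodIso R S (BalTensor S M S) M :=
  ofTensor
    (BalTensor.lift (fun (m : M) (s : S) => op s • m) (fun m m' s => smul_add (op s) m m')
      (fun m s s' => by rw [op_add, add_smul])
      (fun s m a => by rw [smul_eq_mul, op_mul, mul_smul]))
    (fun m => tmul S m (1 : S)) (fun _ _ => add_tmul _ _ _)
    (fun m s => by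
      rw [lift_tmul, BalTensor.smul_tmul, smul_eq_mul, mul_one])
    (fun m => one_smul Sᵐᵒᵖ m)
    (fun r m s => (smul_comm r (op s) m).symm)
    (fun t m s => by
      rw [lift_tmul, lift_tmul, ← mul_smul]; rfl)

section ProdLeft

variable (S) (M M' N : Type*) [AddCommGroup M] [Module Sᵐᵒᵖ M]
  [AddCommGroup M'] [Module Sᵐᵒᵖ M'] [AddCommGroup N] [Module S N]

def prodLeftFwd : BalTensor S (M × M') N →+ BalTensor S M N × BalTensor S M' N :=
  BalTensor.lift (fun (x : M × M') (n : N) => (tmul S x.1 n, tmul S x.2 n))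
    (fun _ _ _ => Prod.ext (add_tmul _ _ _) (add_tmul _ _ _))
    (fun _ _ _ => Prod.ext (tmul_add _ _ _) (tmul_add _ _ _))
    (fun _ _ _ => Prod.ext (BalTensor.smul_tmul _ _ _) (BalTensor.smul_tmul _ _ _))

def prodLeftInl : BalTensor S M N →+ BalTensor S (M × M') N :=
  BalTensor.lift (fun (m : M) (n : N) => tmul S ((m, 0) : M × M') n)
    (fun _ _ _ => by rw [← add_tmul, Prod.mk_add_mk, add_zero])
    (fun _ _ _ => tmul_add _ _ _)
    (fun _ _ _ => by rw [← BalTensor.smul_tmul, Prod.smul_mk, smul_zero])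

def prodLeftInr : BalTensor S M' N →+ BalTensor S (M × M') N :=
  BalTensor.lift (fun (m : M') (n : N) => tmul S ((0, m) : M × M') n)
    (fun _ _ _ => by rw [← add_tmul, Prod.mk_add_mk, add_zero])
    (fun _ _ _ => tmul_add _ _ _)
    (fun _ _ _ => by rw [← BalTensor.smul_tmul, Prod.smul_mk, smul_zero])

theorem prodLeftFwd_inl (x : BalTensor S M N) :
    prodLeftFwd S M M' N (prodLeftInl S M M' N x) = (x, 0) := by
  induction x using BalTensor.induction with
  | ht m n => exact Prod.ext rfl (zero_tmul _)
  | ha x y hx hy => rw [map_add, map_add, hx, hy, Prod.mk_add_mk, add_zero]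

theorem prodLeftFwd_inr (x : BalTensor S M' N) :
    prodLeftFwd S M M' N (prodLeftInr S M M' N x) = (0, x) := by
  induction x using BalTensor.induction with
  | ht m n => exact Prod.ext (zero_tmul _) rfl
  | ha x y hx hy => rw [map_add, map_add, hx, hy, Prod.mk_add_mk, add_zero]

end ProdLeft

def tensorProdLeft (R S T M M' N : Type*) [Ring R] [Ring S] [Ring T]
    [AddCommGroup M] [Module R M] [Module Sᵐᵒᵖ M] [SMulCommClass R Sᵐᵒᵖ M]
    [AddCommGroup M'] [Module R M'] [Module Sᵐᵒᵖ M'] [SMulCommClass R Sᵐᵒᵖ M']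
    [AddCommGroup N] [Module S N] [Module Tᵐᵒᵖ N] [SMulCommClass S Tᵐᵒᵖ N] :
    BimodIso R T (BalTensor S (M × M') N) (BalTensor S M N × BalTensor S M' N) :=
  ofTensor (prodLeftFwd S M M' N)
    (AddMonoidHom.coprod (prodLeftInl S M M' N) (prodLeftInr S M M' N)) (map_add _)
    (fun x n => by
      refine (add_tmul _ _ _).symm.trans ?_
      rw [Prod.mk_add_mk, add_zero, zero_add])
    (fun x => by
      rw [AddMonoidHom.coprod_apply, map_add, prodLeftFwd_inl, prodLeftFwd_inr, Prod.mk_add_mk,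
        add_zero, zero_add])
    (fun _ _ _ => rfl)
    (fun _ _ _ => rfl)

/-- `M ⊗_S N^J ≅ (M ⊗_S N)^J` for a finite index set `J`. -/
def tensorPi (R S T M N J : Type*) [Ring R] [Ring S] [Ring T] [Fintype J] [DecidableEq J]
    [AddCommGroup M] [Module R M] [Module Sᵐᵒᵖ M] [SMulCommClass R Sᵐᵒᵖ M]
    [AddCommGroup N] [Module S N] [Module Tᵐᵒᵖ N] [SMulCommClass S Tᵐᵒᵖ N] :
    BimodIso R T (BalTensor S M (J → N)) (J → BalTensor S M N) :=
  ofTensor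
    (BalTensor.lift (fun (m : M) (x : J → N) => fun j => tmul S m (x j))
      (fun m m' x => funext fun j => add_tmul _ _ _)
      (fun m x x' => funext fun j => tmul_add _ _ _)
      (fun s m x => funext fun j => BalTensor.smul_tmul _ _ _))
    (fun y => ∑ j, BalTensor.lift (fun (m : M) (n : N) => tmul S m (Pi.single j n : J → N))
      (fun m m' n => add_tmul _ _ _)
      (fun m n n' => by rw [Pi.single_add, tmul_add])
      (fun s m n => by rw [BalTensor.smul_tmul, Pi.single_smul']) (y j))
    (fun x y => by
      rw [← Finset.sum_add_distrib]
      exact Finset.sum_congr rfl fun j _ => map_add _ _ _)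
    (fun m x => by
      conv_rhs => rw [← Finset.univ_sum_single x]
      rw [tmul_sum]
      rfl)
    (fun y => by
      have key : ∀ (j : J) (z : BalTensor S M N),
          BalTensor.lift (S := S) (fun (m : M) (x : J → N) => fun j => tmul S m (x j))
            (fun m m' x => funext fun j => add_tmul _ _ _)
            (fun m x x' => funext fun j => tmul_add _ _ _)
            (fun s m x => funext fun j => BalTensor.smul_tmul _ _ _)
            (BalTensor.lift (S := S) (fun (m : M) (n : N) => tmul S m (Pi.single j n : J → N))
              (fun m m' n => add_tmul _ _ _)
              (fun m n n' => by rw [Pi.single_add, tmul_add])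
              (fun s m n => by rw [BalTensor.smul_tmul, Pi.single_smul']) z)
            = Pi.single j z := by
        intro j z
        induction z using BalTensor.induction with
        | ht m n =>
          rw [lift_tmul, lift_tmul]
          funext k
          by_cases h : k = j
          · subst h; rw [Pi.single_eq_same, Pi.single_eq_same]
          · rw [Pi.single_eq_of_ne h, Pi.single_eq_of_ne h, tmul_zero]
        | ha x y hx hy => rw [map_add, map_add, hx, hy, Pi.single_add]
      rw [map_sum]
      simp only [key]
      exact Finset.univ_sum_single y)
    (fun r x n => rfl)
    (fun r x n => rfl)

section ProdRight

variable (S) (M N N' : Type*) [AddCommGroup M] [Module Sᵐᵒᵖ M]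
  [AddCommGroup N] [Module S N] [AddCommGroup N'] [Module S N']

def prodRightFwd : BalTensor S M (N × N') →+ BalTensor S M N × BalTensor S M N' :=
  BalTensor.lift (fun (m : M) (x : N × N') => (tmul S m x.1, tmul S m x.2))
    (fun _ _ _ => Prod.ext (add_tmul _ _ _) (add_tmul _ _ _))
    (fun _ _ _ => Prod.ext (tmul_add _ _ _) (tmul_add _ _ _))
    (fun _ _ _ => Prod.ext (BalTensor.smul_tmul _ _ _) (BalTensor.smul_tmul _ _ _))

def prodRightInl : BalTensor S M N →+ BalTensor S M (N × N') :=
  BalTensor.lift (fun (m : M) (n : N) => tmul S m ((n, 0) : N × N'))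
    (fun _ _ _ => add_tmul _ _ _)
    (fun _ _ _ => by rw [← tmul_add, Prod.mk_add_mk, add_zero])
    (fun _ _ _ => by rw [BalTensor.smul_tmul, Prod.smul_mk, smul_zero])

def prodRightInr : BalTensor S M N' →+ BalTensor S M (N × N') :=
  BalTensor.lift (fun (m : M) (n : N') => tmul S m ((0, n) : N × N'))
    (fun _ _ _ => add_tmul _ _ _)
    (fun _ _ _ => by rw [← tmul_add, Prod.mk_add_mk, add_zero])
    (fun _ _ _ => by rw [BalTensor.smul_tmul, Prod.smul_mk, smul_zero])

theorem prodRightFwd_inl (x : BalTensor S M N) :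
    prodRightFwd S M N N' (prodRightInl S M N N' x) = (x, 0) := by
  induction x using BalTensor.induction with
  | ht m n => exact Prod.ext rfl (tmul_zero _)
  | ha x y hx hy => rw [map_add, map_add, hx, hy, Prod.mk_add_mk, add_zero]

theorem prodRightFwd_inr (x : BalTensor S M N') :
    prodRightFwd S M N N' (prodRightInr S M N N' x) = (0, x) := by
  induction x using BalTensor.induction with
  | ht m n => exact Prod.ext (tmul_zero _) rfl
  | ha x y hx hy => rw [map_add, map_add, hx, hy, Prod.mk_add_mk, add_zero]

end ProdRight

def tensorProdRight (R S T M N N' : Type*) [Ring R] [Ring S] [Ring T]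
    [AddCommGroup M] [Module R M] [Module Sᵐᵒᵖ M] [SMulCommClass R Sᵐᵒᵖ M]
    [AddCommGroup N] [Module S N] [Module Tᵐᵒᵖ N] [SMulCommClass S Tᵐᵒᵖ N]
    [AddCommGroup N'] [Module S N'] [Module Tᵐᵒᵖ N'] [SMulCommClass S Tᵐᵒᵖ N'] :
    BimodIso R T (BalTensor S M (N × N')) (BalTensor S M N × BalTensor S M N') :=
  ofTensor (prodRightFwd S M N N')
    (AddMonoidHom.coprod (prodRightInl S M N N') (prodRightInr S M N N')) (map_add _)
    (fun x n => by
      refine (tmul_add _ _ _).symm.trans ?_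
      rw [Prod.mk_add_mk, add_zero, zero_add])
    (fun x => by
      rw [AddMonoidHom.coprod_apply, map_add, prodRightFwd_inl, prodRightFwd_inr, Prod.mk_add_mk,
        add_zero, zero_add])
    (fun _ _ _ => rfl)
    (fun _ _ _ => rfl)

end Tensor

end BimodIso

end Iso

/-! ## The semiring of trivializable bimodules -/

section Vect

/-- A bimodule over a ring `R`. -/
structure Bimod (R : Type u) [Ring R] : Type (u + 1) where
  carrier : Type u
  [grp : AddCommGroup carrier]
  [left : Module R carrier]
  [right : Module Rᵐᵒᵖ carrier]
  [comm : SMulCommClass R Rᵐᵒᵖ carrier]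

attribute [instance] Bimod.grp Bimod.left Bimod.right Bimod.comm

/-- Let `B` act on the left of the ring `A`, compatibly with the right multiplication of `A`
(for instance `B ⊆ A`). A `B`-bimodule `E` trivializes over `A` if `E ⊗_B A ≅ A^r` as a
`(B, A)`-bimodule for some `r`; on `A^r` both rings act componentwise. -/
def Trivializes (B A E : Type*) [Ring B] [Ring A] [Module B A] [SMulCommClass B Aᵐᵒᵖ A]
    [AddCommGroup E] [Module B E] [Module Bᵐᵒᵖ E] [SMulCommClass B Bᵐᵒᵖ E] : Prop :=
  ∃ r : ℕ, Nonempty (BimodIso B A (BalTensor B E A) (Fin r → A))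

/-- `E` is a `B`-bimodule that is finitely generated and projective as a right `B`-module and
trivializes over `A`. -/
structure IsVect (B A E : Type*) [Ring B] [Ring A] [Module B A] [SMulCommClass B Aᵐᵒᵖ A]
    [AddCommGroup E] [Module B E] [Module Bᵐᵒᵖ E] [SMulCommClass B Bᵐᵒᵖ E] : Prop where
  finite : Module.Finite Bᵐᵒᵖ E
  projective : Module.Projective Bᵐᵒᵖ E
  trivializes : Trivializes B A E

theorem subsingleton_tensor_left (B E F : Type*) [Ring B] [AddCommGroup E] [Module Bᵐᵒᵖ E]
    [AddCommGroup F] [Module B F] [Subsingleton E] : Subsingleton (BalTensor B E F) := by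
  have h : ∀ x : BalTensor B E F, x = 0 := by
    intro x
    induction x using BalTensor.induction with
    | ht m n => rw [Subsingleton.elim m 0, BalTensor.zero_tmul]
    | ha x y hx hy => rw [hx, hy, add_zero]
  exact ⟨fun x y => (h x).trans (h y).symm⟩

theorem subsingleton_tensor_right (B E F : Type*) [Ring B] [AddCommGroup E] [Module Bᵐᵒᵖ E]
    [AddCommGroup F] [Module B F] [Subsingleton F] : Subsingleton (BalTensor B E F) := by
  have h : ∀ x : BalTensor B E F, x = 0 := by
    intro x
    induction x using BalTensor.induction with
    | ht m n => rw [Subsingleton.elim n 0, BalTensor.tmul_zero]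
    | ha x y hx hy => rw [hx, hy, add_zero]
  exact ⟨fun x y => (h x).trans (h y).symm⟩

section Closure

variable {B A : Type*} [Ring B] [Ring A] [Module B A] [SMulCommClass B Aᵐᵒᵖ A]
variable {E F : Type*}
  [AddCommGroup E] [Module B E] [Module Bᵐᵒᵖ E] [SMulCommClass B Bᵐᵒᵖ E]
  [AddCommGroup F] [Module B F] [Module Bᵐᵒᵖ F] [SMulCommClass B Bᵐᵒᵖ F]

theorem Trivializes.of_fintype (J : Type*) [Fintype J]
    (e : BimodIso B A (BalTensor B E A) (J → A)) : Trivializes B A E :=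
  ⟨Fintype.card J, ⟨e.trans (BimodIso.piReindex B A A (Fintype.equivFin J))⟩⟩

theorem Trivializes.prod (hE : Trivializes B A E) (hF : Trivializes B A F) :
    Trivializes B A (E × F) := by
  obtain ⟨r, ⟨e⟩⟩ := hE
  obtain ⟨s, ⟨f⟩⟩ := hF
  exact Trivializes.of_fintype (Fin r ⊕ Fin s)
    (((BimodIso.tensorProdLeft B B A E F A).trans (e.prodCongr f)).trans
      (BimodIso.piSum B A A (Fin r) (Fin s)))

theorem Trivializes.tensor (hE : Trivializes B A E) (hF : Trivializes B A F) :
    Trivializes B A (BalTensor B E F) := by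
  obtain ⟨r, ⟨e⟩⟩ := hE
  obtain ⟨s, ⟨f⟩⟩ := hF
  exact Trivializes.of_fintype (Fin s × Fin r)
    (((((BimodIso.tensorAssoc B B B A E F A).trans
      (BimodIso.tensorCongr (BimodIso.refl B B E) f)).trans
      (BimodIso.tensorPi B B A E A (Fin s))).trans
      (e.piCongr (Fin s))).trans (BimodIso.piCurry B A A (Fin s) (Fin r)))

theorem Trivializes.one (B A : Type*) [Ring B] [Ring A] [Module B A]
    [SMulCommClass B Aᵐᵒᵖ A] : Trivializes B A B :=
  ⟨1, ⟨(BimodIso.tensorLid B A A).trans (BimodIso.piUnique B A A (Fin 1))⟩⟩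

theorem Trivializes.zero (B A : Type*) [Ring B] [Ring A] [Module B A]
    [SMulCommClass B Aᵐᵒᵖ A] : Trivializes B A PUnit.{u + 1} := by
  have := subsingleton_tensor_left B PUnit.{u + 1} A
  exact ⟨0, ⟨BimodIso.ofSubsingleton B A _ _⟩⟩

set_option linter.unusedSectionVars false in
theorem finite_projective_tensor
    (hE : Module.Finite Bᵐᵒᵖ E) (hE' : Module.Projective Bᵐᵒᵖ E)
    (hF : Module.Finite Bᵐᵒᵖ F) (hF' : Module.Projective Bᵐᵒᵖ F) :
    Module.Finite Bᵐᵒᵖ (BalTensor B E F) ∧ Module.Projective Bᵐᵒᵖ (BalTensor B E F) := by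
  obtain ⟨n, s, hs⟩ := Module.Finite.exists_fin' Bᵐᵒᵖ E
  obtain ⟨i, hi⟩ := Module.projective_lifting_property s LinearMap.id hs
  let a : BalTensor B E F →ₗ[Bᵐᵒᵖ] (Fin n → F) :=
    { toFun := BalTensor.lift (fun (e : E) (f : F) => fun k => unop (i e k) • f)
        (fun e e' f => by funext k; simp [add_smul])
        (fun e f f' => by funext k; simp)
        (fun b e f => by funext k; simp [mul_smul])
      map_add' := map_add _
      map_smul' := fun t x => by
        induction x using BalTensor.induction with
        | ht m f =>
          funext k
          exact smul_comm (unop (i m k)) t f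
        | ha x y hx hy => rw [smul_add, map_add, hx, hy, map_add, smul_add] }
  let c : (Fin n → F) →ₗ[Bᵐᵒᵖ] BalTensor B E F :=
    { toFun := fun x => ∑ k, BalTensor.tmul B (s (Pi.single k 1)) (x k)
      map_add' := fun x y => by
        rw [← Finset.sum_add_distrib]
        exact Finset.sum_congr rfl fun k _ => BalTensor.tmul_add _ _ _
      map_smul' := fun t x => by
        rw [RingHom.id_apply, Finset.smul_sum]
        rfl }
  have hca : c ∘ₗ a = LinearMap.id := by
    ext x
    induction x using BalTensor.induction with
    | ht e f =>
      change ∑ k, BalTensor.tmul B (s (Pi.single k 1)) (unop (i e k) • f) = BalTensor.tmul B e f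
      have h : ∀ k, BalTensor.tmul B (s (Pi.single k 1)) (unop (i e k) • f) =
          BalTensor.tmul B (s (Pi.single k (i e k))) f := by
        intro k
        rw [← BalTensor.smul_tmul, op_unop, ← map_smul, ← Pi.single_smul', smul_eq_mul, mul_one]
      simp only [h]
      rw [← BalTensor.sum_tmul, ← map_sum, Finset.univ_sum_single]
      exact congrArg (fun z => BalTensor.tmul B z f) (LinearMap.congr_fun hi e)
    | ha x y hx hy => rw [map_add, hx, hy, map_add]
  have : Module.Projective Bᵐᵒᵖ (Fin n → F) :=
    Module.Projective.of_equiv (DFinsupp.linearEquivFunOnFintype (R := Bᵐᵒᵖ) (M := fun _ : Fin n => F))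
  exact ⟨Module.Finite.of_surjective c fun x => ⟨a x, LinearMap.congr_fun hca x⟩,
    Module.Projective.of_split a c hca⟩

theorem IsVect.tensor (hE : IsVect B A E) (hF : IsVect B A F) : IsVect B A (BalTensor B E F) :=
  ⟨(finite_projective_tensor hE.1 hE.2 hF.1 hF.2).1,
    (finite_projective_tensor hE.1 hE.2 hF.1 hF.2).2, hE.3.tensor hF.3⟩

theorem IsVect.prod (hE : IsVect B A E) (hF : IsVect B A F) : IsVect B A (E × F) := by
  have := hE.1
  have := hE.2
  have := hF.1
  have := hF.2
  exact ⟨inferInstance, inferInstance, hE.3.prod hF.3⟩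

theorem IsVect.one (B A : Type*) [Ring B] [Ring A] [Module B A] [SMulCommClass B Aᵐᵒᵖ A] :
    IsVect B A B := by
  let e : Bᵐᵒᵖ ≃ₗ[Bᵐᵒᵖ] B :=
    { toFun := unop, invFun := op, left_inv := fun _ => rfl, right_inv := fun _ => rfl
      map_add' := fun _ _ => rfl, map_smul' := fun _ _ => rfl }
  exact ⟨Module.Finite.equiv e, Module.Projective.of_equiv e, Trivializes.one B A⟩

theorem IsVect.zero (B A : Type*) [Ring B] [Ring A] [Module B A] [SMulCommClass B Aᵐᵒᵖ A] :
    IsVect B A PUnit.{u + 1} :=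
  ⟨inferInstance, inferInstance, Trivializes.zero B A⟩

end Closure

variable (B A : Type u) [Ring B] [Ring A] [Module B A] [SMulCommClass B Aᵐᵒᵖ A]

/-- The `B`-bimodules, finitely generated projective on the right, that trivialize over `A`. -/
def VectObj : Type (u + 1) := {E : Bimod B // IsVect B A E.carrier}

/-- Isomorphism of bimodules. -/
instance VectObj.setoid : Setoid (VectObj B A) where
  r E F := Nonempty (BimodIso B B E.1.carrier F.1.carrier)
  iseqv := ⟨fun E => ⟨BimodIso.refl B B E.1.carrier⟩, fun ⟨e⟩ => ⟨e.symm⟩,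
    fun ⟨e⟩ ⟨f⟩ => ⟨e.trans f⟩⟩

/-- The isomorphism classes of such bimodules. -/
def Vect : Type (u + 1) := Quotient (VectObj.setoid B A)

variable {B} in
/-- The isomorphism class of `E`. -/
def Vect.mk (E : Type u) [AddCommGroup E] [Module B E] [Module Bᵐᵒᵖ E]
    [SMulCommClass B Bᵐᵒᵖ E] (hE : IsVect B A E) : Vect B A :=
  Quotient.mk (VectObj.setoid B A) ⟨⟨E⟩, hE⟩

/-- Addition is the direct sum, multiplication is the tensor product over `B`. -/
instance : Add (Vect B A) :=
  ⟨Quotient.map₂ (fun E F => ⟨⟨E.1.carrier × F.1.carrier⟩, E.2.prod F.2⟩)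
    (fun _ _ ⟨e⟩ _ _ ⟨f⟩ => ⟨e.prodCongr f⟩)⟩

instance : Mul (Vect B A) :=
  ⟨Quotient.map₂ (fun E F => ⟨⟨BalTensor B E.1.carrier F.1.carrier⟩, E.2.tensor F.2⟩)
    (fun _ _ ⟨e⟩ _ _ ⟨f⟩ => ⟨BimodIso.tensorCongr e f⟩)⟩

instance : Zero (Vect B A) := ⟨Vect.mk A PUnit.{u + 1} (IsVect.zero B A)⟩

instance : One (Vect B A) := ⟨Vect.mk A B (IsVect.one B A)⟩

section

variable {B A}
variable {E F : Type u} [AddCommGroup E] [Module B E] [Module Bᵐᵒᵖ E] [SMulCommClass B Bᵐᵒᵖ E]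
  [AddCommGroup F] [Module B F] [Module Bᵐᵒᵖ F] [SMulCommClass B Bᵐᵒᵖ F]

theorem Vect.mk_add_mk (hE : IsVect B A E) (hF : IsVect B A F) :
    Vect.mk A E hE + Vect.mk A F hF = Vect.mk A (E × F) (hE.prod hF) := rfl

theorem Vect.mk_mul_mk (hE : IsVect B A E) (hF : IsVect B A F) :
    Vect.mk A E hE * Vect.mk A F hF = Vect.mk A (BalTensor B E F) (hE.tensor hF) := rfl

theorem Vect.ind {p : Vect B A → Prop} (h : ∀ (E : VectObj B A), p (Vect.mk A E.1.carrier E.2))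
    (x : Vect B A) : p x :=
  Quotient.ind h x

theorem Vect.mk_eq (hE : IsVect B A E) (hF : IsVect B A F) (e : BimodIso B B E F) :
    Vect.mk A E hE = Vect.mk A F hF :=
  Quotient.sound ⟨e⟩

end

/-- The unital semiring `(Vect_A(B), ⊕, ⊗_B)`. -/
instance : Semiring (Vect B A) where
  add_assoc x y z := by
    induction x using Vect.ind with | h E
    induction y using Vect.ind with | h F
    induction z using Vect.ind with | h G
    exact Vect.mk_eq _ _ (BimodIso.prodAssoc B B _ _ _)
  zero_add x := by
    induction x using Vect.ind with | h E
    exact Vect.mk_eq _ _ (BimodIso.unitProd B B _)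
  add_zero x := by
    induction x using Vect.ind with | h E
    exact Vect.mk_eq _ _ ((BimodIso.prodComm B B _ _).trans (BimodIso.unitProd B B _))
  add_comm x y := by
    induction x using Vect.ind with | h E
    induction y using Vect.ind with | h F
    exact Vect.mk_eq _ _ (BimodIso.prodComm B B _ _)
  left_distrib x y z := by
    induction x using Vect.ind with | h E
    induction y using Vect.ind with | h F
    induction z using Vect.ind with | h G
    exact Vect.mk_eq _ _ (BimodIso.tensorProdRight B B B _ _ _)
  right_distrib x y z := by
    induction x using Vect.ind with | h E
    induction y using Vect.ind with | h F
    induction z using Vect.ind with | h G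
    exact Vect.mk_eq _ _ (BimodIso.tensorProdLeft B B B _ _ _)
  zero_mul x := by
    induction x using Vect.ind with | h E
    have := subsingleton_tensor_left B PUnit.{u + 1} E.1.carrier
    exact Vect.mk_eq _ _ (BimodIso.ofSubsingleton B B _ _)
  mul_zero x := by
    induction x using Vect.ind with | h E
    have := subsingleton_tensor_right B E.1.carrier PUnit.{u + 1}
    exact Vect.mk_eq _ _ (BimodIso.ofSubsingleton B B _ _)
  mul_assoc x y z := by
    induction x using Vect.ind with | h E
    induction y using Vect.ind with | h F
    induction z using Vect.ind with | h G
    exact Vect.mk_eq _ _ (BimodIso.tensorAssoc B B B B _ _ _)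
  one_mul x := by
    induction x using Vect.ind with | h E
    exact Vect.mk_eq _ _ (BimodIso.tensorLid B B _)
  mul_one x := by
    induction x using Vect.ind with | h E
    exact Vect.mk_eq _ _ (BimodIso.tensorRid B B _)
  nsmul := nsmulRec

end Vect

/-! ## Idempotents, `K_0`, trivializing pairs -/

section Idempotents

/-- The right `R`-module `p R^N` of an `N × N` matrix `p`. -/
def idemModule {R : Type*} [Ring R] {N : ℕ} (p : Matrix (Fin N) (Fin N) R) :
    Submodule Rᵐᵒᵖ (Fin N → R) where
  carrier := {x | ∃ y : Fin N → R, x = p.mulVec y}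
  add_mem' := by
    rintro _ _ ⟨x, rfl⟩ ⟨y, rfl⟩
    exact ⟨x + y, (Matrix.mulVec_add _ _ _).symm⟩
  zero_mem' := ⟨0, (Matrix.mulVec_zero _).symm⟩
  smul_mem' := by
    rintro c _ ⟨x, rfl⟩
    exact ⟨c • x, (Matrix.mulVec_smul _ _ _).symm⟩

/-- Idempotents in `M_∞(R)`: idempotent matrices over `R` of arbitrary finite size. -/
def Idem (R : Type*) [Ring R] : Type _ :=
  Σ n : ℕ, {p : Matrix (Fin n) (Fin n) R // IsIdempotentElem p}

/-- Murray-von Neumann equivalence: `p = x y` and `q = y x` for rectangular matrices `x, y`. -/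
def Idem.Equivalent {R : Type*} [Ring R] (p q : Idem R) : Prop :=
  ∃ (x : Matrix (Fin p.1) (Fin q.1) R) (y : Matrix (Fin q.1) (Fin p.1) R),
    p.2.1 = x * y ∧ q.2.1 = y * x

/-- The block diagonal sum of two idempotents. -/
def Idem.sum {R : Type*} [Ring R] (p q : Idem R) : Idem R :=
  ⟨p.1 + q.1, Matrix.reindex finSumFinEquiv finSumFinEquiv
    (Matrix.fromBlocks p.2.1 0 0 q.2.1), by
    have hp : p.2.1 * p.2.1 = p.2.1 := p.2.2
    have hq : q.2.1 * q.2.1 = q.2.1 := q.2.2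
    rw [IsIdempotentElem, Matrix.reindex_apply, Matrix.submatrix_mul_equiv,
      Matrix.fromBlocks_multiply]
    simp [hp, hq]⟩

/-- `K_0` of a unital ring: the abelian group generated by the idempotents in `M_∞(R)`, subject
to `[p] = [q]` for equivalent `p, q` and to `[p ⊕ q] = [p] + [q]`; that is, the Grothendieck
group of the semigroup of equivalence classes of idempotents. -/
def K0 (R : Type*) [Ring R] : Type _ :=
  FreeAbelianGroup (Idem R) ⧸ AddSubgroup.closure
    ({x : FreeAbelianGroup (Idem R) | ∃ p q : Idem R, p.Equivalent q ∧
        x = FreeAbelianGroup.of p - FreeAbelianGroup.of q} ∪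
      {x | ∃ p q : Idem R, x = FreeAbelianGroup.of (p.sum q) -
        (FreeAbelianGroup.of p + FreeAbelianGroup.of q)})

instance (R : Type*) [Ring R] : AddCommGroup (K0 R) :=
  inferInstanceAs (AddCommGroup (FreeAbelianGroup (Idem R) ⧸ AddSubgroup.closure
    ({x : FreeAbelianGroup (Idem R) | ∃ p q : Idem R, p.Equivalent q ∧
        x = FreeAbelianGroup.of p - FreeAbelianGroup.of q} ∪
      {x | ∃ p q : Idem R, x = FreeAbelianGroup.of (p.sum q) -
        (FreeAbelianGroup.of p + FreeAbelianGroup.of q)})))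

/-- The class in `K_0(R)` of an idempotent matrix. -/
def K0.mk {R : Type*} [Ring R] {n : ℕ} (p : Matrix (Fin n) (Fin n) R)
    (hp : IsIdempotentElem p) : K0 R :=
  QuotientAddGroup.mk (FreeAbelianGroup.of (⟨n, p, hp⟩ : Idem R))

theorem isIdempotentElem_map {R S : Type*} [Ring R] [Ring S] (f : R →+* S) {n : ℕ}
    {p : Matrix (Fin n) (Fin n) R} (hp : IsIdempotentElem p) : IsIdempotentElem (p.map f) := by
  have h : p * p = p := hp
  rw [IsIdempotentElem, ← Matrix.map_mul, h]

/-- `(u, v)` is a trivializing pair with `r` columns for the right `B`-module `E`, where `B ⊆ A`.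
Here `Θ` is a trivialization of the right `A`-module `E ⊗_B A`, identifying `e` in `E` with the
vector `Θ (e ⊗ 1)` in `A^r`; `ξ` and `ψ` are the maps `B^N → E` and `E → B^N` given by the
elements `ξ^i` of `E` and the right linear functionals `ψ_i` with `∑ ξ^i ψ_i = id`; they are the
left multiplications by `v` and by `u`. It follows that `ψ` and `ξ` restrict to mutually inverse
isomorphisms between `E` and `p B^N`, where `p = u v`. -/
def IsTrivializingPair {A : Type*} [Ring A] [StarRing A] [Algebra ℂ A] [StarModule ℂ A]
    (B : StarSubalgebra ℂ A) (E : Type*) [AddCommGroup E] [Module Bᵐᵒᵖ E] {N r : ℕ}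
    (u : Matrix (Fin N) (Fin r) A) (v : Matrix (Fin r) (Fin N) A) : Prop :=
  v * u = 1 ∧ (∀ i j, (u * v) i j ∈ B) ∧
  ∃ (Θ : BalTensor B E A ≃ₗ[Aᵐᵒᵖ] (Fin r → A)) (ψ : E →ₗ[Bᵐᵒᵖ] (Fin N → B))
    (ξ : (Fin N → B) →ₗ[Bᵐᵒᵖ] E),
    ξ ∘ₗ ψ = LinearMap.id ∧
    (∀ e : E, (fun i => (ψ e i : A)) = u.mulVec (Θ (BalTensor.tmul B e (1 : A)))) ∧
    (∀ b : Fin N → B, Θ (BalTensor.tmul B (ξ b) (1 : A)) = v.mulVec (fun i => (b i : A)))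

end Idempotents

/-! ## Trace class operators and the enveloping C*-algebra -/

section Analysis

/-- `p` is a C*-seminorm on the *-algebra `A`. -/
structure IsCStarSeminorm {A : Type*} [Ring A] [StarRing A] [Algebra ℂ A]
    (p : Seminorm ℂ A) : Prop where
  mul_le : ∀ a b, p (a * b) ≤ p a * p b
  star_mul_self : ∀ a, p (star a * a) = p a ^ 2

/-- `ι : A → C` exhibits the unital C*-algebra `C` as the C*-enveloping algebra of the unital
*-algebra `A`, that is as the Hausdorff completion of `A` in its greatest C*-seminorm: the range
of `ι` is dense and `a ↦ ‖ι a‖` is the greatest C*-seminorm on `A`. (It is always a C*-seminorm;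
a greatest one exists exactly when the enveloping algebra does.) -/
structure IsCStarEnvelope {A : Type*} [Ring A] [StarRing A] [Algebra ℂ A]
    {C : Type*} [CStarAlgebra C] (ι : A →⋆ₐ[ℂ] C) : Prop where
  dense : DenseRange ι
  le_norm : ∀ p : Seminorm ℂ A, IsCStarSeminorm p → ∀ a, p a ≤ ‖ι a‖

variable {H : Type w} [NormedAddCommGroup H] [InnerProductSpace ℂ H] [CompleteSpace H]

/-- `T` is of trace class: `∑ ⟨e_j, |T| e_j⟩ < ∞` for an orthonormal basis `(e_j)`, where
`|T| = (T* T)^{1/2}`. (The sum of this series of nonnegative terms does not depend on the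
basis.) -/
def IsTraceClass (T : H →L[ℂ] H) : Prop :=
  ∃ (J : Type w) (e : HilbertBasis J ℂ H),
    Summable fun j => (inner ℂ (e j) (CFC.abs T (e j)) : ℂ)

/-- The operator `T` has trace `c`: in every orthonormal basis `∑ ⟨e_j, T e_j⟩` converges
unconditionally to `c`. -/
def HasTrace (T : H →L[ℂ] H) (c : ℂ) : Prop :=
  ∀ (J : Type w) (e : HilbertBasis J ℂ H),
    HasSum (fun j => (inner ℂ (e j) (T (e j)) : ℂ)) c

end Analysis

end NCBundle

end

open NCBundle

noncomputable section

namespace NCBundle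

/-! Both coefficients of `ch` come from homomorphisms on `K_0` of the enveloping algebra. For a
representation `φ` of the `*`-subalgebra `B`, the function `b ↦ ‖φ b‖` is a C*-seminorm, hence
bounded by `‖ι b‖`; so `ε` and `π` restricted to `B` extend to continuous homomorphisms `χ` and `ρ`
on `C` (`IsCStarEnvelope.exists_extension`). The first coefficient is the rank of the complex
idempotent `χ(p)`.

For the second, put `σ = χ · 1`. On the image of `B` the difference `ρ - σ` is of trace class, so on
all of `C` it lies in the norm closure of the finite rank operators. An idempotent over `C`
therefore gives idempotents `P = ρ(p)` and `Q = σ(p)` on `H^n` whose difference is approximable but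
need not have a trace. Conjugating `P` by an invertible operator close to a finite rank perturbation
of the identity produces `P'` with `P' - Q` of finite rank (`exists_pairEquiv_finiteRank`), and `tr
(P' - Q)` is a difference of two ranks (`exists_ntr_sub_eq_intCast`). This integer, `relIndex P Q`,
does not depend on `P'`: the trace of a nuclear difference is unchanged by intertwiners that agree
only up to approximable operators (`PairEquiv.ntr_sub_eq`). It is additive and invariant under
equivalence of idempotents, and equals `tr (P - Q)` when `P - Q` is nuclear. For `p` over `B` this
is the trace in the theorem. Nuclear operators replace trace class ones throughout: ideal properties
and cyclicity of the trace are easy for them, and `IsTraceClass.mem_nuclear` connects the two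
notions.

Multiplicativity of `ch` is where trivializations matter. If `q` represents `E'`, a left action by
`b` becomes a matrix `L(b)` over `B` with `L(1) = q`, and `E ⊗ E'` is represented by the block
matrix `(L(p_ij))`, of trace `Tr L(Tr p)`. A trivialization of `E'` gives `u`, `v` over `A` with `v
u = 1` and `L(b) = u b v` (`exists_matrices_of_trivializes`). Splitting `π(b)` into `ε(b)` and a
nuclear defect, and moving `π(u)` cyclically past it, turns the trace of the defect of `Tr (u b v)`
into `ε(b) tr(defect (Tr q)) + r tr(defect b)` (`trace_defect_conj`). This is the product rule
modulo `t²`. -/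

/-! ## Nuclear operators and their trace -/

set_option linter.unusedSectionVars false

section Nuclear

open InnerProductSpace ContinuousLinearMap

variable {E F G : Type w}
  [NormedAddCommGroup E] [InnerProductSpace ℂ E] [CompleteSpace E]
  [NormedAddCommGroup F] [InnerProductSpace ℂ F] [CompleteSpace F]
  [NormedAddCommGroup G] [InnerProductSpace ℂ G] [CompleteSpace G]

/-- `T = ∑ |x i⟩⟨y i|` with `∑ ‖x i‖ ‖y i‖ < ∞`. -/
structure NuclearRep {I : Type*} (x : I → F) (y : I → E) (T : E →L[ℂ] F) : Prop where
  summable : Summable fun i => ‖x i‖ * ‖y i‖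
  hasSum : HasSum (fun i => rankOne ℂ (x i) (y i)) T

variable (E F) in
/-- The nuclear operators. -/
def nuclear : Submodule ℂ (E →L[ℂ] F) where
  carrier := {T | ∃ (I : Type w) (x : I → F) (y : I → E), NuclearRep x y T}
  zero_mem' := ⟨PEmpty, PEmpty.elim, PEmpty.elim, summable_empty, hasSum_empty⟩
  add_mem' := by
    rintro S T ⟨I, x, y, h⟩ ⟨J, x', y', h'⟩
    refine ⟨I ⊕ J, Sum.elim x x', Sum.elim y y', ?_, ?_⟩
    · exact (HasSum.sum (f := fun i : I ⊕ J => ‖Sum.elim x x' i‖ * ‖Sum.elim y y' i‖)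
        h.summable.hasSum h'.summable.hasSum).summable
    · exact HasSum.sum (f := fun i : I ⊕ J => rankOne ℂ (Sum.elim x x' i) (Sum.elim y y' i))
        h.hasSum h'.hasSum
  smul_mem' := by
    rintro c T ⟨I, x, y, h⟩
    refine ⟨I, fun i => c • x i, y, ?_, ?_⟩
    · simpa only [norm_smul, mul_assoc] using h.summable.mul_left ‖c‖
    · simpa only [map_smul, smul_apply] using h.hasSum.const_smul c

theorem NuclearRep.mem {I : Type w} {x : I → F} {y : I → E} {T : E →L[ℂ] F}
    (h : NuclearRep x y T) : T ∈ nuclear E F := ⟨I, x, y, h⟩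

theorem NuclearRep.comp_left {I : Type*} {x : I → F} {y : I → E} {T : E →L[ℂ] F}
    (h : NuclearRep x y T) (S : F →L[ℂ] G) : NuclearRep (fun i => S (x i)) y (S ∘L T) where
  summable := by
    refine Summable.of_nonneg_of_le (fun _ => by positivity) (fun i => ?_)
      (h.summable.mul_left ‖S‖)
    rw [← mul_assoc]
    exact mul_le_mul_of_nonneg_right (S.le_opNorm _) (norm_nonneg _)
  hasSum := by
    simpa only [compL_apply, comp_rankOne] using h.hasSum.mapL (compL ℂ E F G S)

theorem NuclearRep.comp_right {I : Type*} {x : I → F} {y : I → E} {T : E →L[ℂ] F}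
    (h : NuclearRep x y T) (S : G →L[ℂ] E) :
    NuclearRep x (fun i => adjoint S (y i)) (T ∘L S) where
  summable := by
    refine Summable.of_nonneg_of_le (fun _ => by positivity) (fun i => ?_)
      (h.summable.mul_right ‖adjoint S‖)
    rw [mul_assoc, mul_comm ‖y i‖]
    exact mul_le_mul_of_nonneg_left ((adjoint S).le_opNorm _) (norm_nonneg _)
  hasSum := by
    simpa only [flip_apply, compL_apply, rankOne_comp] using
      h.hasSum.mapL ((compL ℂ G E F).flip S)

theorem comp_mem_nuclear (S : F →L[ℂ] G) {T : E →L[ℂ] F} (hT : T ∈ nuclear E F) :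
    S ∘L T ∈ nuclear E G := by
  obtain ⟨I, x, y, h⟩ := hT
  exact (h.comp_left S).mem

theorem mem_nuclear_comp {T : E →L[ℂ] F} (hT : T ∈ nuclear E F) (S : G →L[ℂ] E) :
    T ∘L S ∈ nuclear G F := by
  obtain ⟨I, x, y, h⟩ := hT
  exact (h.comp_right S).mem

/-- Cauchy–Schwarz in `ℓ²` combined with Parseval for `x` and for `y`. The bound is what allows
double sums over a nuclear expansion and a basis to be interchanged. -/
theorem summable_norm_inner_mul_inner {I : Type*} (e : HilbertBasis I ℂ E) (x y : E) :
    Summable (fun j => ‖inner ℂ y (e j) * inner ℂ (e j) x‖) ∧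
      ∑' j, ‖inner ℂ y (e j) * inner ℂ (e j) x‖ ≤ ‖x‖ * ‖y‖ := by
  -- The exponent is the real number `2` because the Hölder inequality applied below has real
  -- exponents.
  have sq : ∀ z : E, HasSum (fun j => ‖inner ℂ (e j) z‖ ^ (2 : ℝ)) (‖z‖ ^ (2 : ℝ)) := by
    intro z
    have h := e.hasSum_inner_mul_inner z z
    rw [inner_self_eq_norm_sq_to_K] at h
    have h' := Complex.hasSum_re h
    convert h' using 1
    · funext j
      rw [← inner_conj_symm z, Complex.conj_mul']
      norm_cast
    · norm_cast
  have hy : HasSum (fun j => ‖inner ℂ y (e j)‖ ^ (2 : ℝ)) (‖y‖ ^ (2 : ℝ)) := by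
    simpa only [norm_inner_symm y] using sq y
  obtain ⟨-, h2⟩ := Real.summable_and_inner_le_Lp_mul_Lq_tsum_of_nonneg
    Real.HolderConjugate.two_two (fun j => norm_nonneg (inner ℂ y (e j)))
    (fun j => norm_nonneg (inner ℂ (e j) x)) hy.summable (sq x).summable
  have h1 := (Real.summable_and_inner_le_Lp_mul_Lq_tsum_of_nonneg
    Real.HolderConjugate.two_two (fun j => norm_nonneg (inner ℂ y (e j)))
    (fun j => norm_nonneg (inner ℂ (e j) x)) hy.summable (sq x).summable).1
  simp only [norm_mul]
  refine ⟨h1, h2.trans ?_⟩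
  rw [hy.tsum_eq, (sq x).tsum_eq, mul_comm, ← Real.rpow_mul (norm_nonneg _),
    ← Real.rpow_mul (norm_nonneg _)]
  norm_num

/-- The family `⟨y_i, e_j⟩⟨e_j, x_i⟩` is absolutely summable over pairs. Summing over `j` first
gives `⟨y_i, x_i⟩` by Parseval; summing over `i` first gives `⟨e_j, T e_j⟩`. Hence the diagonal sum
depends neither on the basis nor on the nuclear expansion. -/
theorem NuclearRep.hasSum_inner {I J : Type*} {x y : I → E} {T : E →L[ℂ] E}
    (h : NuclearRep x y T) (e : HilbertBasis J ℂ E) :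
    HasSum (fun j => (inner ℂ (e j) (T (e j)) : ℂ)) (∑' i, inner ℂ (y i) (x i)) := by
  have hs : Summable fun p : I × J => inner ℂ (y p.1) (e p.2) * inner ℂ (e p.2) (x p.1) := by
    refine Summable.of_norm ((summable_prod_of_nonneg fun _ => norm_nonneg _).2
      ⟨fun i => (summable_norm_inner_mul_inner e (x i) (y i)).1, ?_⟩)
    exact Summable.of_nonneg_of_le (fun i => tsum_nonneg fun _ => norm_nonneg _)
      (fun i => (summable_norm_inner_mul_inner e (x i) (y i)).2) h.summable
  have hrow : ∀ i, HasSum (fun j => inner ℂ (y i) (e j) * inner ℂ (e j) (x i))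
      (inner ℂ (y i) (x i)) := fun i => e.hasSum_inner_mul_inner _ _
  have hcol : ∀ j, HasSum (fun i => inner ℂ (y i) (e j) * inner ℂ (e j) (x i))
      (inner ℂ (e j) (T (e j))) := by
    intro j
    have := (h.hasSum.mapL (ContinuousLinearMap.apply ℂ E (e j))).mapL (innerSL ℂ (e j))
    simpa [inner_smul_right] using this
  have htot : HasSum (fun p : I × J => inner ℂ (y p.1) (e p.2) * inner ℂ (e p.2) (x p.1))
      (∑' i, inner ℂ (y i) (x i)) := by
    convert hs.hasSum using 1
    exact (hs.hasSum.prod_fiberwise hrow).tsum_eq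
  exact ((Equiv.prodComm J I).hasSum_iff.2 htot).prod_fiberwise hcol

/-- The trace of an operator, computed in some orthonormal basis. -/
def ntr (T : E →L[ℂ] E) : ℂ :=
  ∑' j, inner ℂ ((exists_hilbertBasis ℂ E).choose_spec.choose j)
    (T ((exists_hilbertBasis ℂ E).choose_spec.choose j))

theorem NuclearRep.ntr_eq {I : Type*} {x y : I → E} {T : E →L[ℂ] E} (h : NuclearRep x y T) :
    ntr T = ∑' i, inner ℂ (y i) (x i) :=
  (h.hasSum_inner _).tsum_eq

theorem hasSum_ntr {T : E →L[ℂ] E} (hT : T ∈ nuclear E E) {J : Type*}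
    (e : HilbertBasis J ℂ E) : HasSum (fun j => (inner ℂ (e j) (T (e j)) : ℂ)) (ntr T) := by
  obtain ⟨I, x, y, h⟩ := hT
  rw [h.ntr_eq]
  exact h.hasSum_inner e

theorem hasTrace_ntr {T : E →L[ℂ] E} (hT : T ∈ nuclear E E) : HasTrace T (ntr T) :=
  fun _ e => hasSum_ntr hT e

theorem ntr_add {S T : E →L[ℂ] E} (hS : S ∈ nuclear E E) (hT : T ∈ nuclear E E) :
    ntr (S + T) = ntr S + ntr T := by
  refine ((hasSum_ntr (add_mem hS hT) (exists_hilbertBasis ℂ E).choose_spec.choose).unique ?_)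
  simpa only [add_apply, inner_add_right] using (hasSum_ntr hS _).add (hasSum_ntr hT _)

theorem ntr_smul (c : ℂ) {T : E →L[ℂ] E} (hT : T ∈ nuclear E E) :
    ntr (c • T) = c * ntr T := by
  refine ((hasSum_ntr (Submodule.smul_mem _ c hT)
    (exists_hilbertBasis ℂ E).choose_spec.choose).unique ?_)
  simpa only [smul_apply, inner_smul_right] using (hasSum_ntr hT _).mul_left c

theorem ntr_zero : ntr (0 : E →L[ℂ] E) = 0 := by
  simpa using ntr_smul 0 (zero_mem (nuclear E E))

theorem ntr_sum {J : Type*} (s : Finset J) (T : J → E →L[ℂ] E)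
    (hT : ∀ j, T j ∈ nuclear E E) : ntr (∑ j ∈ s, T j) = ∑ j ∈ s, ntr (T j) := by
  classical
  induction s using Finset.induction_on with
  | empty => simpa using ntr_zero
  | insert a s ha ih =>
    rw [Finset.sum_insert ha, Finset.sum_insert ha,
      ntr_add (hT a) (Submodule.sum_mem _ fun j _ => hT j), ih]

/-- An expansion of `S` yields expansions of both composites, and both traces become `∑ ⟨y_i, T
x_i⟩`. Only one factor has to be nuclear, and the two spaces may differ; moving inclusions and
projections around in this way is used repeatedly below. -/
theorem ntr_comp_comm {S : E →L[ℂ] F} (hS : S ∈ nuclear E F) (T : F →L[ℂ] E) :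
    ntr (T ∘L S) = ntr (S ∘L T) := by
  obtain ⟨I, x, y, h⟩ := hS
  rw [(h.comp_left T).ntr_eq, (h.comp_right T).ntr_eq]
  simp only [adjoint_inner_left]

/-! ### Finite rank and approximable operators, and integrality of the trace. -/

variable (E F) in
/-- The operators of finite rank. -/
def finiteRank : Submodule ℂ (E →L[ℂ] F) :=
  Submodule.span ℂ {T | ∃ (x : F) (y : E), T = rankOne ℂ x y}

variable (E F) in
/-- The norm closure of the operators of finite rank. -/
def approximable : Submodule ℂ (E →L[ℂ] F) := (finiteRank E F).topologicalClosure

theorem finiteRank_le_nuclear : finiteRank E F ≤ nuclear E F := by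
  refine Submodule.span_le.2 ?_
  rintro _ ⟨x, y, rfl⟩
  exact NuclearRep.mem (I := PUnit) (x := fun _ => x) (y := fun _ => y)
    ⟨(hasSum_fintype _).summable, by simp⟩

theorem nuclear_le_approximable : nuclear E F ≤ approximable E F := by
  rintro T ⟨I, x, y, h⟩
  exact mem_closure_of_tendsto h.hasSum (Filter.Eventually.of_forall fun s =>
    Submodule.sum_mem _ fun i _ => Submodule.subset_span ⟨_, _, rfl⟩)

theorem comp_mem_finiteRank (S : F →L[ℂ] G) {T : E →L[ℂ] F} (hT : T ∈ finiteRank E F) :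
    S ∘L T ∈ finiteRank E G := by
  suffices h : finiteRank E F ≤ (finiteRank E G).comap (compL ℂ E F G S).toLinearMap from h hT
  refine Submodule.span_le.2 ?_
  rintro _ ⟨x, y, rfl⟩
  exact Submodule.subset_span ⟨S x, y, comp_rankOne x y S⟩

theorem mem_finiteRank_comp {T : E →L[ℂ] F} (hT : T ∈ finiteRank E F) (S : G →L[ℂ] E) :
    T ∘L S ∈ finiteRank G F := by
  suffices h : finiteRank E F ≤
      (finiteRank G F).comap ((compL ℂ G E F).flip S).toLinearMap from h hT
  refine Submodule.span_le.2 ?_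
  rintro _ ⟨x, y, rfl⟩
  exact Submodule.subset_span ⟨x, adjoint S y, rankOne_comp x y S⟩

theorem comp_mem_approximable (S : F →L[ℂ] G) {T : E →L[ℂ] F} (hT : T ∈ approximable E F) :
    S ∘L T ∈ approximable E G :=
  map_mem_closure (compL ℂ E F G S).continuous hT fun _ h => comp_mem_finiteRank S h

theorem mem_approximable_comp {T : E →L[ℂ] F} (hT : T ∈ approximable E F) (S : G →L[ℂ] E) :
    T ∘L S ∈ approximable G F :=
  map_mem_closure (f := (compL ℂ G E F).flip S) ((compL ℂ G E F).flip S).continuous hT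
    fun _ h => mem_finiteRank_comp h S

theorem finiteRank_le_approximable : finiteRank E F ≤ approximable E F :=
  Submodule.le_topologicalClosure _

theorem finiteDimensional_range_of_mem_finiteRank {T : E →L[ℂ] F} (hT : T ∈ finiteRank E F) :
    FiniteDimensional ℂ (LinearMap.range T.toLinearMap) := by
  induction hT using Submodule.span_induction with
  | mem T h =>
    obtain ⟨x, y, rfl⟩ := h
    refine Submodule.finiteDimensional_of_le (S₂ := Submodule.span ℂ {x}) ?_
    rintro _ ⟨z, rfl⟩
    exact Submodule.smul_mem _ _ (Submodule.mem_span_singleton_self x)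
  | zero =>
    refine Submodule.finiteDimensional_of_le (S₂ := (⊥ : Submodule ℂ F)) ?_
    rintro _ ⟨z, rfl⟩
    exact zero_mem _
  | add S T _ _ hS hT =>
    refine Submodule.finiteDimensional_of_le (S₂ := LinearMap.range S.toLinearMap ⊔
      LinearMap.range T.toLinearMap) ?_
    rintro _ ⟨z, rfl⟩
    exact Submodule.add_mem_sup ⟨z, rfl⟩ ⟨z, rfl⟩
  | smul c T _ hT =>
    refine Submodule.finiteDimensional_of_le (S₂ := LinearMap.range T.toLinearMap) ?_
    rintro _ ⟨z, rfl⟩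
    exact Submodule.smul_mem _ _ ⟨z, rfl⟩

theorem ntr_eq_trace [FiniteDimensional ℂ E] {T : E →L[ℂ] E} (hT : T ∈ nuclear E E) :
    ntr T = LinearMap.trace ℂ E T.toLinearMap := by
  rw [LinearMap.trace_eq_sum_inner _ (stdOrthonormalBasis ℂ E)]
  refine (hasSum_ntr hT (stdOrthonormalBasis ℂ E).toHilbertBasis).unique ?_
  simpa using hasSum_fintype _

/-- The trace of a projection is the dimension of its range. -/
theorem exists_trace_eq_natCast {V : Type*} [AddCommGroup V] [Module ℂ V]
    [FiniteDimensional ℂ V] {f : V →ₗ[ℂ] V} (hf : IsIdempotentElem f) :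
    ∃ n : ℕ, LinearMap.trace ℂ V f = n :=
  ⟨_, ((LinearMap.isProj_range_iff_isIdempotentElem f).2 hf).trace⟩

/-- The finite-dimensional space `W = ran D + P (ran D)`, with `D = P - Q`, contains the range of
`D`, is invariant under `P` because `P² = P`, and hence under `Q = P - D`. The trace of `D` can be
computed on `W`, where it is the rank of `P|W` minus the rank of `Q|W`. -/
theorem exists_ntr_sub_eq_intCast {P Q : E →L[ℂ] E} (hP : IsIdempotentElem P)
    (hQ : IsIdempotentElem Q) (h : P - Q ∈ finiteRank E E) : ∃ n : ℤ, ntr (P - Q) = n := by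
  have hfd := finiteDimensional_range_of_mem_finiteRank h
  let W : Submodule ℂ E := LinearMap.range (P - Q).toLinearMap ⊔
    (LinearMap.range (P - Q).toLinearMap).map P.toLinearMap
  have hW : FiniteDimensional ℂ W := Submodule.finiteDimensional_sup _ _
  have hD : ∀ x, (P - Q) x ∈ W := fun x => Submodule.mem_sup_left ⟨x, rfl⟩
  have hPP : ∀ x, P (P x) = P x := fun x => congrArg (fun T : E →L[ℂ] E => T x) hP
  have hQQ : ∀ x, Q (Q x) = Q x := fun x => congrArg (fun T : E →L[ℂ] E => T x) hQ
  have hPW : ∀ x ∈ W, P x ∈ W := by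
    intro x hx
    obtain ⟨a, ha, b, ⟨c, hc, rfl⟩, rfl⟩ := Submodule.mem_sup.1 hx
    rw [map_add]
    refine add_mem (Submodule.mem_sup_right ⟨a, ha, rfl⟩) (Submodule.mem_sup_right ⟨c, hc, ?_⟩)
    exact (hPP c).symm
  have hQW : ∀ x ∈ W, Q x ∈ W := by
    intro x hx
    have := sub_mem (hPW x hx) (hD x)
    rwa [sub_apply, sub_sub_cancel] at this
  let p : E →L[ℂ] W := W.orthogonalProjectionOnto
  have hp : ∀ x ∈ W, (p x : E) = x := fun x hx =>
    Submodule.starProjection_eq_self_iff.2 hx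
  let f : (E →L[ℂ] E) → (W →L[ℂ] W) := fun T => p ∘L (T ∘L W.subtypeL)
  have hf : ∀ T : E →L[ℂ] E, (∀ x ∈ W, T x ∈ W) → (∀ x, T (T x) = T x) →
      IsIdempotentElem (f T).toLinearMap := by
    intro T hT hTT
    ext x
    change (p (T (p (T x))) : E) = p (T x)
    rw [hp _ (hT _ x.2), hTT, hp _ (hT _ x.2)]
  -- `D` factors through `W`; cyclicity then moves the inclusion of `W` to the right, so that the
  -- trace is taken on `W`.
  have h1 : W.subtypeL ∘L (p ∘L (P - Q)) = P - Q := by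
    ext x
    exact hp _ (hD x)
  have h2 : p ∘L (P - Q) ∈ nuclear E W := comp_mem_nuclear _ (finiteRank_le_nuclear h)
  have h3 : (p ∘L (P - Q)) ∘L W.subtypeL = f P - f Q := by
    ext x
    simp [f]
  obtain ⟨m, hm⟩ := exists_trace_eq_natCast (hf P hPW hPP)
  obtain ⟨n, hn⟩ := exists_trace_eq_natCast (hf Q hQW hQQ)
  refine ⟨m - n, ?_⟩
  rw [← h1, ntr_comp_comm h2, ntr_eq_trace (mem_nuclear_comp h2 _), h3,
    ContinuousLinearMap.toLinearMap_sub, map_sub, hm, hn]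
  push_cast
  rfl

end Nuclear

/-! ## The relative index of two idempotents with compact difference -/

section RelIndex

set_option linter.unusedSectionVars false

open ContinuousLinearMap

variable {E F G : Type w}
  [NormedAddCommGroup E] [InnerProductSpace ℂ E] [CompleteSpace E]
  [NormedAddCommGroup F] [InnerProductSpace ℂ F] [CompleteSpace F]
  [NormedAddCommGroup G] [InnerProductSpace ℂ G] [CompleteSpace G]

/-- The pairs of idempotents `(P, Q)` and `(P', Q')` are equivalent by intertwiners that agree up
to approximable operators. -/
def PairEquiv (P Q : E →L[ℂ] E) (P' Q' : F →L[ℂ] F) : Prop :=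
  ∃ (X X₀ : F →L[ℂ] E) (Y Y₀ : E →L[ℂ] F),
    X - X₀ ∈ approximable F E ∧ Y - Y₀ ∈ approximable E F ∧
    X ∘L Y = P ∧ Y ∘L X = P' ∧ X₀ ∘L Y₀ = Q ∧ Y₀ ∘L X₀ = Q'

theorem PairEquiv.symm {P Q : E →L[ℂ] E} {P' Q' : F →L[ℂ] F} (h : PairEquiv P Q P' Q') :
    PairEquiv P' Q' P Q := by
  obtain ⟨X, X₀, Y, Y₀, h1, h2, h3, h4, h5, h6⟩ := h
  exact ⟨Y, Y₀, X, X₀, h2, h1, h4, h3, h6, h5⟩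

/-- Telescoping: replace one factor at a time and use the ideal property. The nuclear version below
has the same proof. -/
theorem comp_sub_comp_mem_approximable {X X₀ : F →L[ℂ] G} {Y Y₀ : E →L[ℂ] F}
    (hX : X - X₀ ∈ approximable F G) (hY : Y - Y₀ ∈ approximable E F) :
    X ∘L Y - X₀ ∘L Y₀ ∈ approximable E G := by
  have h : X ∘L Y - X₀ ∘L Y₀ = (X - X₀) ∘L Y + X₀ ∘L (Y - Y₀) := by
    rw [sub_comp, comp_sub]; abel
  rw [h]
  exact add_mem (mem_approximable_comp hX _) (comp_mem_approximable _ hY)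

theorem comp_sub_comp_mem_nuclear {X X₀ : F →L[ℂ] G} {Y Y₀ : E →L[ℂ] F}
    (hX : X - X₀ ∈ nuclear F G) (hY : Y - Y₀ ∈ nuclear E F) :
    X ∘L Y - X₀ ∘L Y₀ ∈ nuclear E G := by
  have h : X ∘L Y - X₀ ∘L Y₀ = (X - X₀) ∘L Y + X₀ ∘L (Y - Y₀) := by
    rw [sub_comp, comp_sub]; abel
  rw [h]
  exact add_mem (mem_nuclear_comp hX _) (comp_mem_nuclear _ hY)

/-- Composing the intertwiners produces `P²` and `P''²`, and likewise `Q²` and `Q''²`, so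
idempotency of the outer operators closes the argument. -/
theorem PairEquiv.trans {P Q : E →L[ℂ] E} {P' Q' : F →L[ℂ] F} {P'' Q'' : G →L[ℂ] G}
    (hP : IsIdempotentElem P) (hQ : IsIdempotentElem Q)
    (hP'' : IsIdempotentElem P'') (hQ'' : IsIdempotentElem Q'')
    (h : PairEquiv P Q P' Q') (h' : PairEquiv P' Q' P'' Q'') : PairEquiv P Q P'' Q'' := by
  have key : ∀ {P : E →L[ℂ] E} {P' : F →L[ℂ] F} {P'' : G →L[ℂ] G}
      {X : F →L[ℂ] E} {Y : E →L[ℂ] F} {X' : G →L[ℂ] F} {Y' : F →L[ℂ] G},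
      IsIdempotentElem P → IsIdempotentElem P'' → X ∘L Y = P → Y ∘L X = P' →
      X' ∘L Y' = P' → Y' ∘L X' = P'' →
      (X ∘L X') ∘L (Y' ∘L Y) = P ∧ (Y' ∘L Y) ∘L (X ∘L X') = P'' := by
    intro P P' P'' X Y X' Y' hP hP'' h1 h2 h3 h4
    constructor
    · calc (X ∘L X') ∘L (Y' ∘L Y) = X ∘L (X' ∘L Y') ∘L Y := rfl
        _ = X ∘L (Y ∘L X) ∘L Y := by rw [h3, h2]
        _ = (X ∘L Y) ∘L (X ∘L Y) := rfl
        _ = P := by rw [h1]; exact hP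
    · calc (Y' ∘L Y) ∘L (X ∘L X') = Y' ∘L (Y ∘L X) ∘L X' := rfl
        _ = Y' ∘L (X' ∘L Y') ∘L X' := by rw [h3, h2]
        _ = (Y' ∘L X') ∘L (Y' ∘L X') := rfl
        _ = P'' := by rw [h4]; exact hP''
  obtain ⟨X, X₀, Y, Y₀, h1, h2, h3, h4, h5, h6⟩ := h
  obtain ⟨X', X₀', Y', Y₀', h1', h2', h3', h4', h5', h6'⟩ := h'
  exact ⟨X ∘L X', X₀ ∘L X₀', Y' ∘L Y, Y₀' ∘L Y₀, comp_sub_comp_mem_approximable h1 h1',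
    comp_sub_comp_mem_approximable h2' h2, (key hP hP'' h3 h4 h3' h4').1,
    (key hP hP'' h3 h4 h3' h4').2, (key hQ hQ'' h5 h6 h5' h6').1, (key hQ hQ'' h5 h6 h5' h6').2⟩

theorem PairEquiv.refl {P Q : E →L[ℂ] E} (hP : IsIdempotentElem P) (hQ : IsIdempotentElem Q)
    (h : P - Q ∈ approximable E E) : PairEquiv P Q P Q :=
  ⟨P, Q, P, Q, h, h, hP, hP, hQ, hQ⟩

/-- The two differences are telescoped in opposite orders, so that the terms correspond under
cyclicity. None of the four products needs to have a trace by itself. -/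
theorem ntr_comp_sub_comp {X X₀ : F →L[ℂ] E} {Y Y₀ : E →L[ℂ] F}
    (hX : X - X₀ ∈ nuclear F E) (hY : Y - Y₀ ∈ nuclear E F) :
    ntr (X ∘L Y - X₀ ∘L Y₀) = ntr (Y ∘L X - Y₀ ∘L X₀) := by
  have h1 : X ∘L Y - X₀ ∘L Y₀ = (X - X₀) ∘L Y + X₀ ∘L (Y - Y₀) := by
    rw [sub_comp, comp_sub]; abel
  have h2 : Y ∘L X - Y₀ ∘L X₀ = Y ∘L (X - X₀) + (Y - Y₀) ∘L X₀ := by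
    rw [sub_comp, comp_sub]; abel
  rw [h1, h2, ntr_add (mem_nuclear_comp hX _) (comp_mem_nuclear _ hY),
    ntr_add (comp_mem_nuclear _ hX) (mem_nuclear_comp hY _), ntr_comp_comm hX, ntr_comp_comm hY]

/-- From `k⁻¹ - 1 = -k⁻¹ (k - 1)` and the ideal property. -/
theorem inverse_sub_one_mem_nuclear {k : E →L[ℂ] E} (hk : IsUnit k) (h : k - 1 ∈ nuclear E E) :
    Ring.inverse k - 1 ∈ nuclear E E := by
  have : Ring.inverse k - 1 = -(Ring.inverse k * (k - 1)) := by
    rw [mul_sub, Ring.inverse_mul_cancel _ hk, mul_one, neg_sub]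
  rw [this]
  exact neg_mem (comp_mem_nuclear _ h)

/-- If `X - X₀` and `Y - Y₀` were nuclear, `ntr_comp_sub_comp` would suffice. They are only
approximable, so `X` and `Y` are replaced by nearby `x`, `y` that differ from `X₀`, `Y₀` by nuclear
operators. The products `x y` and `y x` are then only close to `P` and `P'`, and this is repaired by
dividing by an invertible operator close to `1`. -/
theorem ntr_sub_eq_of_intertwiners {P Q : E →L[ℂ] E} {P' Q' : F →L[ℂ] F}
    {X X₀ : F →L[ℂ] E} {Y Y₀ : E →L[ℂ] F}
    (hX : X - X₀ ∈ approximable F E) (hY : Y - Y₀ ∈ approximable E F)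
    (hXY : X ∘L Y = P) (hYX : Y ∘L X = P') (hXY₀ : X₀ ∘L Y₀ = Q) (hYX₀ : Y₀ ∘L X₀ = Q')
    (hP : IsIdempotentElem P) (hP' : IsIdempotentElem P')
    (hPX : P ∘L X = X) (hXP : X ∘L P' = X) (hPY : P' ∘L Y = Y) (hYP : Y ∘L P = Y)
    (hQX : Q ∘L X₀ = X₀) (hXQ : X₀ ∘L Q' = X₀) (hQY : Q' ∘L Y₀ = Y₀) (hYQ : Y₀ ∘L Q = Y₀)
    (h : P - Q ∈ nuclear E E) (h' : P' - Q' ∈ nuclear F F) :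
    ntr (P - Q) = ntr (P' - Q') := by
  let c : (F →L[ℂ] E) → F →L[ℂ] E := fun a => P ∘L (X₀ + a) ∘L P'
  let d : (E →L[ℂ] F) → E →L[ℂ] F := fun b => P' ∘L (Y₀ + b) ∘L P
  let k : (F →L[ℂ] E) × (E →L[ℂ] F) → E →L[ℂ] E := fun z => c z.1 ∘L d z.2 + (1 - P)
  let l : (F →L[ℂ] E) × (E →L[ℂ] F) → F →L[ℂ] F := fun z => d z.2 ∘L c z.1 + (1 - P')
  have hk : Continuous k := by fun_prop
  have hl : Continuous l := by fun_prop
  -- At the point `(X - X₀, Y - Y₀)` both `k` and `l` equal `1`. Units are open and this point is a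
  -- limit of pairs of finite rank operators, so some such pair `(a, b)` makes both values
  -- invertible.
  have hcX : c (X - X₀) = X := by
    simp only [c, add_sub_cancel, hXP, hPX]
  have hdY : d (Y - Y₀) = Y := by
    simp only [d, add_sub_cancel, hYP, hPY]
  have hmem : ((X - X₀, Y - Y₀) : (F →L[ℂ] E) × (E →L[ℂ] F)) ∈
      closure ((finiteRank F E : Set (F →L[ℂ] E)) ×ˢ (finiteRank E F : Set (E →L[ℂ] F))) := by
    rw [closure_prod_eq]
    exact ⟨hX, hY⟩
  have hopen : IsOpen ({z | IsUnit (k z)} ∩ {z | IsUnit (l z)}) :=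
    (Units.isOpen.preimage hk).inter (Units.isOpen.preimage hl)
  obtain ⟨⟨a, b⟩, ⟨hka, hlb⟩, ha, hb⟩ := mem_closure_iff.1 hmem _ hopen (by
    constructor
    · simp only [Set.mem_ofPred_eq, k, hcX, hdY, hXY, add_sub_cancel, isUnit_one]
    · simp only [Set.mem_ofPred_eq, l, hcX, hdY, hYX, add_sub_cancel, isUnit_one])
  have hc : c a - X₀ ∈ nuclear F E := by
    -- Writing `X₀ = Q X₀ Q'` turns the difference into one governed by the nuclear operators `P -
    -- Q` and `P' - Q'`, plus a finite rank term.
    have e : c a - X₀ = (P ∘L X₀ ∘L P' - Q ∘L X₀ ∘L Q') + P ∘L a ∘L P' := by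
      simp only [c, hXQ, hQX, add_comp, comp_add]; abel
    rw [e]
    refine add_mem (comp_sub_comp_mem_nuclear h (comp_sub_comp_mem_nuclear ?_ h')) ?_
    · rw [sub_self]; exact zero_mem _
    · exact comp_mem_nuclear _ (mem_nuclear_comp (finiteRank_le_nuclear ha) _)
  have hd : d b - Y₀ ∈ nuclear E F := by
    have e : d b - Y₀ = (P' ∘L Y₀ ∘L P - Q' ∘L Y₀ ∘L Q) + P' ∘L b ∘L P := by
      simp only [d, hYQ, hQY, add_comp, comp_add]; abel
    rw [e]
    refine add_mem (comp_sub_comp_mem_nuclear h' (comp_sub_comp_mem_nuclear ?_ h)) ?_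
    · rw [sub_self]; exact zero_mem _
    · exact comp_mem_nuclear _ (mem_nuclear_comp (finiteRank_le_nuclear hb) _)
  have hPc : P ∘L c a = c a := congrArg (fun T => T ∘L (X₀ + a) ∘L P') hP
  have hdP : d b ∘L P = d b := congrArg (fun T => P' ∘L (Y₀ + b) ∘L T) hP
  have hPd : P' ∘L d b = d b := congrArg (fun T => T ∘L (Y₀ + b) ∘L P) hP'
  have hcP : c a ∘L P' = c a := congrArg (fun T => P ∘L (X₀ + a) ∘L T) hP'
  set x := c a
  set y := d b
  have hkdef : k (a, b) = x ∘L y + (1 - P) := rfl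
  have hldef : l (a, b) = y ∘L x + (1 - P') := rfl
  -- `κ` is `x y` on the range of `P` and the identity on its kernel; `μ` is the same for `y x` and
  -- `P'`. Hence `κ` commutes with `P` and `κ x = x μ`.
  set κ := k (a, b)
  set μ := l (a, b)
  have hκP : κ * P = x ∘L y := by
    rw [hkdef, add_mul, sub_mul, one_mul, hP, sub_self, add_zero]
    exact congrArg (fun T => x ∘L T) hdP
  have hPμ : P' * μ = y ∘L x := by
    rw [hldef, mul_add, mul_sub, mul_one, hP', sub_self, add_zero]
    exact congrArg (fun T => T ∘L x) hPd
  have hPκ : P * κ = κ * P := by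
    rw [hκP, hkdef, mul_add, mul_sub, mul_one, hP, sub_self, add_zero]
    exact congrArg (fun T => T ∘L y) hPc
  have hκx : κ ∘L x = x ∘L μ := by
    rw [hkdef, hldef, add_comp, comp_add, sub_comp, comp_sub, hPc, hcP]
    simp only [ContinuousLinearMap.one_def, id_comp, comp_id, sub_self]
    rfl
  have hκ1 : κ - 1 ∈ nuclear E E := by
    have e : κ - 1 = (x ∘L y - X₀ ∘L Y₀) - (P - Q) := by rw [hkdef, hXY₀]; abel
    rw [e]
    exact sub_mem (comp_sub_comp_mem_nuclear hc hd) h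
  -- The corrected partner of `x` is `y κ⁻¹`. It still differs from `Y₀` by a nuclear operator since
  -- `κ - 1` is nuclear, and with `x` it gives exactly `P` and `P'`.
  have hy : y ∘L Ring.inverse κ - Y₀ ∘L 1 ∈ nuclear E F :=
    comp_sub_comp_mem_nuclear hd (inverse_sub_one_mem_nuclear hka hκ1)
  rw [ContinuousLinearMap.one_def, comp_id] at hy
  have e1 : x ∘L (y ∘L Ring.inverse κ) = P := by
    calc x ∘L (y ∘L Ring.inverse κ) = (x ∘L y) * Ring.inverse κ := rfl
      _ = P := by rw [← hκP, ← hPκ, mul_assoc, Ring.mul_inverse_cancel _ hka, mul_one]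
  have e2 : (y ∘L Ring.inverse κ) ∘L x = P' := by
    have e3 : Ring.inverse κ ∘L x = x ∘L Ring.inverse μ := by
      calc Ring.inverse κ ∘L x = Ring.inverse κ ∘L x ∘L (μ * Ring.inverse μ) := by
            rw [Ring.mul_inverse_cancel _ hlb]; rfl
        _ = Ring.inverse κ ∘L (x ∘L μ) ∘L Ring.inverse μ := rfl
        _ = (Ring.inverse κ * κ) ∘L x ∘L Ring.inverse μ := by rw [← hκx]; rfl
        _ = x ∘L Ring.inverse μ := by rw [Ring.inverse_mul_cancel _ hka]; rfl
    calc (y ∘L Ring.inverse κ) ∘L x = y ∘L (Ring.inverse κ ∘L x) := rfl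
      _ = (y ∘L x) * Ring.inverse μ := by rw [e3]; rfl
      _ = P' := by rw [← hPμ, mul_assoc, Ring.mul_inverse_cancel _ hlb, mul_one]
  have := ntr_comp_sub_comp hc hy
  rwa [e1, e2, hXY₀, hYX₀] at this

/-- Replacing `X, Y` by `P X, P' Y` and `X₀, Y₀` by `Q X₀, Q' Y₀` normalizes the intertwiners so
that the idempotents act as identities on them. Their differences stay approximable because `P - Q`
and `P' - Q'` are. -/
theorem PairEquiv.ntr_sub_eq {P Q : E →L[ℂ] E} {P' Q' : F →L[ℂ] F}
    (hP : IsIdempotentElem P) (hQ : IsIdempotentElem Q)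
    (hP' : IsIdempotentElem P') (hQ' : IsIdempotentElem Q')
    (e : PairEquiv P Q P' Q') (h : P - Q ∈ nuclear E E) (h' : P' - Q' ∈ nuclear F F) :
    ntr (P - Q) = ntr (P' - Q') := by
  have key : ∀ {P : E →L[ℂ] E} {P' : F →L[ℂ] F} {X : F →L[ℂ] E} {Y : E →L[ℂ] F},
      IsIdempotentElem P → IsIdempotentElem P' → X ∘L Y = P → Y ∘L X = P' →
      (P ∘L X) ∘L (P' ∘L Y) = P ∧ (P' ∘L Y) ∘L (P ∘L X) = P' ∧
      P ∘L (P ∘L X) = P ∘L X ∧ (P ∘L X) ∘L P' = P ∘L X ∧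
      P' ∘L (P' ∘L Y) = P' ∘L Y ∧ (P' ∘L Y) ∘L P = P' ∘L Y := by
    intro P P' X Y hP hP' h1 h2
    have hP3 : P ∘L (P ∘L P) = P := (congrArg (fun T => P ∘L T) hP).trans hP
    have hP3' : P' ∘L (P' ∘L P') = P' := (congrArg (fun T => P' ∘L T) hP').trans hP'
    refine ⟨?_, ?_, ?_, ?_, ?_, ?_⟩
    · calc (P ∘L X) ∘L (P' ∘L Y) = P ∘L X ∘L (Y ∘L X) ∘L Y := by rw [h2]; rfl
        _ = P ∘L (X ∘L Y) ∘L (X ∘L Y) := rfl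
        _ = P := by rw [h1, hP3]
    · calc (P' ∘L Y) ∘L (P ∘L X) = P' ∘L Y ∘L (X ∘L Y) ∘L X := by rw [h1]; rfl
        _ = P' ∘L (Y ∘L X) ∘L (Y ∘L X) := rfl
        _ = P' := by rw [h2, hP3']
    · exact congrArg (fun T => T ∘L X) hP
    · calc (P ∘L X) ∘L P' = P ∘L X ∘L (Y ∘L X) := by rw [h2]; rfl
        _ = P ∘L (X ∘L Y) ∘L X := rfl
        _ = P ∘L P ∘L X := by rw [h1]
        _ = P ∘L X := congrArg (fun T => T ∘L X) hP
    · exact congrArg (fun T => T ∘L Y) hP'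
    · calc (P' ∘L Y) ∘L P = P' ∘L Y ∘L (X ∘L Y) := by rw [h1]; rfl
        _ = P' ∘L (Y ∘L X) ∘L Y := rfl
        _ = P' ∘L P' ∘L Y := by rw [h2]
        _ = P' ∘L Y := congrArg (fun T => T ∘L Y) hP'
  obtain ⟨X, X₀, Y, Y₀, h1, h2, h3, h4, h5, h6⟩ := e
  obtain ⟨a1, a2, a3, a4, a5, a6⟩ := key hP hP' h3 h4
  obtain ⟨b1, b2, b3, b4, b5, b6⟩ := key hQ hQ' h5 h6
  exact ntr_sub_eq_of_intertwiners
    (comp_sub_comp_mem_approximable (nuclear_le_approximable h) h1)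
    (comp_sub_comp_mem_approximable (nuclear_le_approximable h') h2)
    a1 a2 b1 b2 hP hP' a3 a4 a5 a6 b3 b4 b5 b6 h h'

/-- The operator `G = P Q + (1 - P)(1 - Q)` satisfies `P G = G Q` but need not be invertible. It is
the identity plus an approximable operator, so it factors as `U (1 + F')` with `U` invertible and
`F'` of finite rank. Then `P' = U⁻¹ P U` satisfies `P' (1 + F') = (1 + F') Q`, so `P' - Q` has
finite rank. -/
theorem exists_pairEquiv_finiteRank {P Q : E →L[ℂ] E} (hP : IsIdempotentElem P)
    (hQ : IsIdempotentElem Q) (h : P - Q ∈ approximable E E) :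
    ∃ P' : E →L[ℂ] E, IsIdempotentElem P' ∧ P' - Q ∈ finiteRank E E ∧ PairEquiv P Q P' Q := by
  -- Chosen so that `1 + K` is the intertwiner `P Q + (1 - P)(1 - Q)` while `K` is visibly a
  -- multiple of `P - Q`.
  let K : E →L[ℂ] E := (P - Q) * (2 * Q - 1)
  have hK : K ∈ approximable E E := mem_approximable_comp h _
  have hG : P * (1 + K) = (1 + K) * Q := by
    have hP' : P * P = P := hP
    have hQ' : Q * Q = Q := hQ
    have : (1 + K) = P * Q + (1 - P) * (1 - Q) := by
      simp only [K, two_mul, mul_sub, sub_mul, mul_add, mul_one, one_mul, hQ']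
      abel
    rw [this]
    have hP1 : P * (1 - P) = 0 := by rw [mul_sub, mul_one, hP', sub_self]
    have hQ1 : (1 - Q) * Q = 0 := by rw [sub_mul, one_mul, hQ', sub_self]
    rw [mul_add, add_mul, ← mul_assoc, ← mul_assoc, hP', hP1, mul_assoc P Q Q, hQ',
      mul_assoc (1 - P), hQ1, zero_mul, mul_zero]
  have hcont : Continuous fun F : E →L[ℂ] E => 1 + (K - F) := by fun_prop
  -- `F` is a finite rank approximation of `K` close enough for `1 + (K - F)` to be a unit; at `F =
  -- K` its value is `1`.
  obtain ⟨F, hU, hF⟩ := mem_closure_iff.1 (show K ∈ closure (finiteRank E E : Set (E →L[ℂ] E))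
    from hK) _ (Units.isOpen.preimage hcont) (by simp)
  obtain ⟨U, hU⟩ := hU
  replace hU : (U : E →L[ℂ] E) = 1 + (K - F) := hU
  have hUF : (1 + K) = U * (1 + ↑U⁻¹ * F) := by
    rw [mul_add, mul_one, Units.mul_inv_cancel_left, hU]; abel
  have hF' : (↑U⁻¹ * F : E →L[ℂ] E) ∈ finiteRank E E := comp_mem_finiteRank _ hF
  set F' : E →L[ℂ] E := ↑U⁻¹ * F
  have hcomm : ↑U⁻¹ * P * U * (1 + F') = (1 + F') * Q := by
    rw [mul_assoc, ← hUF, mul_assoc, hG, hUF, mul_assoc, Units.inv_mul_cancel_left]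
  have hU1 : (U : E →L[ℂ] E) - 1 ∈ approximable E E := by
    rw [hU, add_sub_cancel_left]
    exact sub_mem hK (finiteRank_le_approximable hF)
  have hU2 : (↑U⁻¹ : E →L[ℂ] E) - 1 ∈ approximable E E := by
    have : (↑U⁻¹ : E →L[ℂ] E) - 1 = -(↑U⁻¹ * (↑U - 1)) := by
      rw [mul_sub, Units.inv_mul, mul_one, neg_sub]
    rw [this]
    exact neg_mem (comp_mem_approximable _ hU1)
  refine ⟨↑U⁻¹ * P * U, ?_, ?_, ?_⟩
  · change ↑U⁻¹ * P * U * (↑U⁻¹ * P * U) = ↑U⁻¹ * P * U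
    rw [mul_assoc (↑U⁻¹ * P), ← mul_assoc (U : E →L[ℂ] E), ← mul_assoc (U : E →L[ℂ] E),
      Units.mul_inv, one_mul, ← mul_assoc, mul_assoc _ P P, hP]
  · have : ↑U⁻¹ * P * U - Q = F' * Q - ↑U⁻¹ * P * U * F' := by
      rw [mul_add, mul_one, add_mul, one_mul] at hcomm
      rw [sub_eq_sub_iff_add_eq_add, hcomm, add_comm]
    rw [this]
    exact sub_mem (mem_finiteRank_comp hF' _) (comp_mem_finiteRank _ hF')
  -- `U` and `U⁻¹ P` intertwine `P` with `P'`, while `1` and `Q` intertwine `Q` with itself; they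
  -- match up to approximables since `U - 1`, `U⁻¹ - 1` and `P - Q` are approximable.
  · refine ⟨U, 1, ↑U⁻¹ * P, Q, hU1, ?_, ?_, rfl, rfl, rfl⟩
    · have := comp_sub_comp_mem_approximable hU2 h
      exact this
    · exact Units.mul_inv_cancel_left U P

/-! ### The integer-valued index and its properties. -/

theorem exists_relIndex {P Q : E →L[ℂ] E} (hP : IsIdempotentElem P)
    (hQ : IsIdempotentElem Q) (h : P - Q ∈ approximable E E) :
    ∃ n : ℤ, ∃ P' : E →L[ℂ] E, IsIdempotentElem P' ∧ P' - Q ∈ nuclear E E ∧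
      PairEquiv P Q P' Q ∧ ntr (P' - Q) = n := by
  obtain ⟨P', h1, h2, h3⟩ := exists_pairEquiv_finiteRank hP hQ h
  obtain ⟨n, hn⟩ := exists_ntr_sub_eq_intCast h1 hQ h2
  exact ⟨n, P', h1, finiteRank_le_nuclear h2, h3, hn⟩

open scoped Classical in
/-- The index of `P` relative to `Q` for idempotents `P`, `Q` with approximable difference: the
trace of `P' - Q` for any `P'` equivalent to `P` such that `P' - Q` is nuclear. -/
def relIndex (P Q : E →L[ℂ] E) : ℤ :=
  if h : IsIdempotentElem P ∧ IsIdempotentElem Q ∧ P - Q ∈ approximable E E then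
    (exists_relIndex h.1 h.2.1 h.2.2).choose else 0

theorem relIndex_spec {P Q : E →L[ℂ] E} (hP : IsIdempotentElem P)
    (hQ : IsIdempotentElem Q) (h : P - Q ∈ approximable E E) :
    ∃ P' : E →L[ℂ] E, IsIdempotentElem P' ∧ P' - Q ∈ nuclear E E ∧
      PairEquiv P Q P' Q ∧ ntr (P' - Q) = relIndex P Q := by
  rw [relIndex, dif_pos ⟨hP, hQ, h⟩]
  exact (exists_relIndex hP hQ h).choose_spec

/-- Independence of the choice: any nuclear representative is equivalent, through `(P, Q)`, to the
chosen one, and equivalent nuclear pairs have equal traces. -/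
theorem PairEquiv.ntr_eq_relIndex {P Q : E →L[ℂ] E} {P' Q' : F →L[ℂ] F}
    (hP : IsIdempotentElem P) (hQ : IsIdempotentElem Q)
    (hP' : IsIdempotentElem P') (hQ' : IsIdempotentElem Q')
    (h : P - Q ∈ approximable E E) (e : PairEquiv P Q P' Q') (h' : P' - Q' ∈ nuclear F F) :
    ntr (P' - Q') = relIndex P Q := by
  obtain ⟨R, hR, h1, h2, h3⟩ := relIndex_spec hP hQ h
  rw [← h3]
  exact (e.symm.trans hP' hQ' hR hQ h2).ntr_sub_eq hP' hQ' hR hQ h' h1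

/-- The pair is its own nuclear representative. In particular the trace of a nuclear difference of
idempotents is an integer. -/
theorem ntr_sub_eq_relIndex {P Q : E →L[ℂ] E}
    (hP : IsIdempotentElem P) (hQ : IsIdempotentElem Q) (h : P - Q ∈ nuclear E E) :
    ntr (P - Q) = relIndex P Q :=
  (PairEquiv.refl hP hQ (nuclear_le_approximable h)).ntr_eq_relIndex hP hQ hP hQ
    (nuclear_le_approximable h) h

theorem PairEquiv.relIndex_eq {P Q : E →L[ℂ] E} {P' Q' : F →L[ℂ] F}
    (hP : IsIdempotentElem P) (hQ : IsIdempotentElem Q)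
    (hP' : IsIdempotentElem P') (hQ' : IsIdempotentElem Q')
    (h : P - Q ∈ approximable E E) (h' : P' - Q' ∈ approximable F F)
    (e : PairEquiv P Q P' Q') : relIndex P Q = relIndex P' Q' := by
  obtain ⟨R, hR, h1, h2, h3⟩ := relIndex_spec hP' hQ' h'
  have := (e.trans hP hQ hR hQ' h2).ntr_eq_relIndex hP hQ hR hQ' h h1
  exact_mod_cast this.symm.trans h3

/-- Additivity of the relative index, for direct sums given by inclusions and projections. -/
theorem relIndex_directSum {P Q : E →L[ℂ] E} {P' Q' : F →L[ℂ] F}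
    (hP : IsIdempotentElem P) (hQ : IsIdempotentElem Q)
    (hP' : IsIdempotentElem P') (hQ' : IsIdempotentElem Q')
    (h : P - Q ∈ approximable E E) (h' : P' - Q' ∈ approximable F F)
    {i : E →L[ℂ] G} {r : G →L[ℂ] E} {i' : F →L[ℂ] G} {r' : G →L[ℂ] F}
    (hri : r ∘L i = 1) (hri' : r' ∘L i' = 1) (h0 : r ∘L i' = 0) (h0' : r' ∘L i = 0) :
    relIndex (i ∘L P ∘L r + i' ∘L P' ∘L r') (i ∘L Q ∘L r + i' ∘L Q' ∘L r') =
      relIndex P Q + relIndex P' Q' := by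
  have mul : ∀ (A B : E →L[ℂ] E) (A' B' : F →L[ℂ] F),
      (i ∘L A ∘L r + i' ∘L A' ∘L r') ∘L (i ∘L B ∘L r + i' ∘L B' ∘L r') =
        i ∘L (A ∘L B) ∘L r + i' ∘L (A' ∘L B') ∘L r' := by
    intro A B A' B'
    have k1 : ∀ x, r (i x) = x := fun x => congrArg (fun T : E →L[ℂ] E => T x) hri
    have k2 : ∀ x, r' (i' x) = x := fun x => congrArg (fun T : F →L[ℂ] F => T x) hri'
    have k3 : ∀ x, r (i' x) = 0 := fun x => congrArg (fun T : F →L[ℂ] E => T x) h0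
    have k4 : ∀ x, r' (i x) = 0 := fun x => congrArg (fun T : E →L[ℂ] F => T x) h0'
    ext x
    simp [k1, k2, k3, k4]
  have sub : ∀ (A B : E →L[ℂ] E) (A' B' : F →L[ℂ] F),
      (i ∘L A ∘L r + i' ∘L A' ∘L r') - (i ∘L B ∘L r + i' ∘L B' ∘L r') =
        i ∘L (A - B) ∘L r + i' ∘L (A' - B') ∘L r' := by
    intro A B A' B'
    simp only [sub_comp, comp_sub]
    abel
  have idem : ∀ {A : E →L[ℂ] E} {A' : F →L[ℂ] F}, IsIdempotentElem A → IsIdempotentElem A' →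
      IsIdempotentElem (i ∘L A ∘L r + i' ∘L A' ∘L r') := by
    intro A A' hA hA'
    refine (mul A A A' A').trans ?_
    rw [show A ∘L A = A from hA, show A' ∘L A' = A' from hA']
  have appr : ∀ {A B : E →L[ℂ] E} {A' B' : F →L[ℂ] F}, A - B ∈ approximable E E →
      A' - B' ∈ approximable F F →
      (i ∘L A ∘L r + i' ∘L A' ∘L r') - (i ∘L B ∘L r + i' ∘L B' ∘L r') ∈ approximable G G := by
    intro A B A' B' hA hA'
    rw [sub]
    exact add_mem (comp_mem_approximable _ (mem_approximable_comp hA _))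
      (comp_mem_approximable _ (mem_approximable_comp hA' _))
  obtain ⟨R, hR, h1, ⟨X, X₀, Y, Y₀, a1, a2, a3, a4, a5, a6⟩, h3⟩ := relIndex_spec hP hQ h
  obtain ⟨R', hR', h1', ⟨X', X₀', Y', Y₀', b1, b2, b3, b4, b5, b6⟩, h3'⟩ :=
    relIndex_spec hP' hQ' h'
  have e : PairEquiv (i ∘L P ∘L r + i' ∘L P' ∘L r') (i ∘L Q ∘L r + i' ∘L Q' ∘L r')
      (i ∘L R ∘L r + i' ∘L R' ∘L r') (i ∘L Q ∘L r + i' ∘L Q' ∘L r') := by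
    -- The intertwiners are the direct sums of those of the two summands; their form is read off
    -- from the two membership proofs.
    refine ⟨_, _, _, _, appr a1 b1, appr a2 b2, ?_, ?_, ?_, ?_⟩
    · rw [mul, a3, b3]
    · rw [mul, a4, b4]
    · rw [mul, a5, b5]
    · rw [mul, a6, b6]
  have hn : i ∘L (R - Q) ∘L r ∈ nuclear G G := comp_mem_nuclear _ (mem_nuclear_comp h1 _)
  have hn' : i' ∘L (R' - Q') ∘L r' ∈ nuclear G G := comp_mem_nuclear _ (mem_nuclear_comp h1' _)
  have key := e.ntr_eq_relIndex (idem hP hP') (idem hQ hQ') (idem hR hR') (idem hQ hQ')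
    (appr h h') (by rw [sub]; exact add_mem hn hn')
  -- Cyclicity brings each inclusion next to its projection, and `r i = 1`, `r' i' = 1` reduce to
  -- the traces on the summands.
  rw [sub, ntr_add hn hn', ntr_comp_comm (mem_nuclear_comp h1 _),
    ntr_comp_comm (mem_nuclear_comp h1' _), comp_assoc, comp_assoc, hri, hri',
    ContinuousLinearMap.one_def, ContinuousLinearMap.one_def, comp_id, comp_id, h3, h3'] at key
  exact_mod_cast key.symm

end RelIndex

/-! ## Trace class operators are nuclear -/

section TraceClass

open InnerProductSpace ContinuousLinearMap

variable {H : Type w} [NormedAddCommGroup H] [InnerProductSpace ℂ H] [CompleteSpace H]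

/-- The assignment `S x ↦ T x` is well defined and bounded on the range of `S`, since `‖T x‖ = ‖S (S
x)‖ ≤ ‖S‖ ‖S x‖`. It extends by continuity to the closure of the range and by zero to the orthogonal
complement, on which `S` vanishes by self-adjointness. -/
theorem exists_factor_of_norm_eq {T S : H →L[ℂ] H} (hS : IsSelfAdjoint S)
    (h : ∀ x, ‖T x‖ = ‖S (S x)‖) :
    ∃ X : H →L[ℂ] H, X ∘L S = T ∧ ∀ y, ‖X y‖ = ‖S y‖ := by
  let W : Submodule ℂ H := (LinearMap.range S.toLinearMap).topologicalClosure
  have hW : IsClosed (W : Set H) := Submodule.isClosed_topologicalClosure _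
  have : CompleteSpace W := hW.completeSpace_coe
  have hmem : ∀ x, S x ∈ W := fun x => Submodule.le_topologicalClosure _ ⟨x, rfl⟩
  let e : H →ₗ[ℂ] W := S.toLinearMap.codRestrict W hmem
  have he : DenseRange e := by
    intro w
    rw [Metric.mem_closure_iff]
    intro δ hδ
    obtain ⟨_, ⟨x, rfl⟩, hx⟩ := Metric.mem_closure_iff.1 w.2 δ hδ
    exact ⟨e x, ⟨x, rfl⟩, hx⟩
  have hb : ∃ C, ∀ x, ‖T.toLinearMap x‖ ≤ C * ‖e x‖ :=
    ⟨‖S‖, fun x => (h x).le.trans (S.le_opNorm _)⟩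
  let X₀ : W →L[ℂ] H := T.toLinearMap.extendOfNorm e
  have hX₀ : ∀ x, X₀ (e x) = T x := fun x => LinearMap.extendOfNorm_eq he hb x
  have hX₀n : ∀ w : W, ‖X₀ w‖ = ‖S w‖ := by
    refine isClosed_property he (isClosed_eq (by fun_prop) (by fun_prop)) fun x => ?_
    rw [hX₀]
    exact h x
  have hp : ∀ y (hy : y ∈ W), W.orthogonalProjectionOnto y = ⟨y, hy⟩ := fun y hy =>
    Subtype.ext (Submodule.starProjection_eq_self_iff.2 hy)
  refine ⟨X₀ ∘L W.orthogonalProjectionOnto, ?_, fun y => ?_⟩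
  · ext x
    change X₀ (W.orthogonalProjectionOnto (S x)) = T x
    rw [hp _ (hmem x)]
    exact hX₀ x
  · change ‖X₀ (W.orthogonalProjectionOnto y)‖ = ‖S y‖
    rw [hX₀n]
    congr 1
    -- The vector `y` minus its projection is orthogonal to the range of `S`, so self-adjointness
    -- shows that `S` kills it.
    rw [← sub_eq_zero, ← map_sub, ← inner_self_eq_zero (𝕜 := ℂ)]
    have hadj : ∀ a b, inner ℂ (S a) b = inner ℂ a (S b) := fun a b => by
      conv_lhs => rw [← hS.adjoint_eq, adjoint_inner_left]
    rw [hadj]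
    have := W.sub_starProjection_mem_orthogonal y
    rw [← neg_sub, inner_neg_left, neg_eq_zero]
    exact (Submodule.mem_orthogonal' _ _).1 this _ (hmem _)

/-- With `S = |T|^{1/2}`, factor `T = X S` where `‖X y‖ = ‖S y‖`. Expanding `S z` in the basis gives
`T = ∑ |X e_j⟩⟨S e_j|`, and `∑ ‖X e_j‖ ‖S e_j‖ = ∑ ‖S e_j‖² = ∑ ⟨e_j, |T| e_j⟩` is finite. -/
theorem IsTraceClass.mem_nuclear {T : H →L[ℂ] H} (hT : IsTraceClass T) : T ∈ nuclear H H := by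
  obtain ⟨J, e, he⟩ := hT
  set A : H →L[ℂ] H := CFC.abs T
  have hA : 0 ≤ A := CFC.abs_nonneg T
  set S : H →L[ℂ] H := CFC.sqrt A
  have hSA : S * S = A := CFC.sqrt_mul_sqrt_self A hA
  have hS : IsSelfAdjoint S := IsSelfAdjoint.of_nonneg (CFC.sqrt_nonneg A)
  have hnorm : ∀ x, ‖T x‖ = ‖S (S x)‖ := by
    intro x
    have h1 : A * A = star T * T := CFC.abs_mul_abs T
    have h2 : ‖T x‖ ^ 2 = ‖A x‖ ^ 2 := by
      rw [T.apply_norm_sq_eq_inner_adjoint_left, A.apply_norm_sq_eq_inner_adjoint_left,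
        (IsSelfAdjoint.of_nonneg hA).adjoint_eq]
      change RCLike.re (inner ℂ ((star T * T) x) x) = RCLike.re (inner ℂ ((A * A) x) x)
      rw [h1]
    have h3 : ‖T x‖ = ‖A x‖ := (sq_eq_sq₀ (norm_nonneg _) (norm_nonneg _)).1 h2
    rw [h3, ← hSA]
    rfl
  obtain ⟨X, hXS, hX⟩ := exists_factor_of_norm_eq hS hnorm
  have hsq : Summable fun j => ‖X (e j)‖ * ‖S (e j)‖ := by
    have := Complex.hasSum_re he.hasSum
    refine this.summable.congr fun j => ?_
    rw [hX, ← sq, S.apply_norm_sq_eq_inner_adjoint_right, hS.adjoint_eq]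
    change (inner ℂ (e j) (A (e j)) : ℂ).re = (inner ℂ (e j) ((S * S) (e j)) : ℂ).re
    rw [hSA]
  refine NuclearRep.mem (x := fun j => X (e j)) (y := fun j => S (e j)) ⟨hsq, ?_⟩
  have hs : Summable fun j => rankOne ℂ (X (e j)) (S (e j)) :=
    Summable.of_norm (by simpa only [norm_rankOne] using hsq)
  convert hs.hasSum using 1
  -- The operator series already converges absolutely in norm, so its sum can be identified with `T`
  -- pointwise.
  ext z
  refine HasSum.unique ?_ (hs.hasSum.mapL (ContinuousLinearMap.apply ℂ H z))
  have h1 := (e.hasSum_repr (S z)).mapL X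
  rw [show X (S z) = T z from congrArg (fun R : H →L[ℂ] H => R z) hXS] at h1
  convert h1 using 1
  funext j
  rw [map_smul, e.repr_apply_apply]
  change inner ℂ (S (e j)) z • X (e j) = _
  rw [← adjoint_inner_right, hS.adjoint_eq]

end TraceClass

/-! ## Operators given by matrices of operators -/

section Block

set_option linter.unusedSectionVars false

open ContinuousLinearMap

variable {H : Type w} [NormedAddCommGroup H] [InnerProductSpace ℂ H] [CompleteSpace H]

/-- The Hilbert space `H^J`. -/
abbrev HPow (J : Type) (H : Type w) : Type w := PiLp 2 fun _ : J => H

variable {I J K : Type} [Fintype I] [Fintype J] [Fintype K]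
  [DecidableEq I] [DecidableEq J] [DecidableEq K]

/-- The `j`-th inclusion of `H` into `H^J`. -/
def blockIncl (j : J) : H →L[ℂ] HPow J H :=
  (PiLp.continuousLinearEquiv 2 ℂ fun _ : J => H).symm.toContinuousLinearMap ∘L
    ContinuousLinearMap.single ℂ (fun _ : J => H) j

/-- The `j`-th projection of `H^J` onto `H`. -/
def blockProj (j : J) : HPow J H →L[ℂ] H :=
  ContinuousLinearMap.proj j ∘L
    (PiLp.continuousLinearEquiv 2 ℂ fun _ : J => H).toContinuousLinearMap

theorem blockProj_apply (j : J) (x : HPow J H) : blockProj j x = x j := rfl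

theorem blockIncl_apply (i j : J) (x : H) : blockIncl j x i = if i = j then x else 0 :=
  Pi.single_apply j x i

/-- The operator from `H^J` to `H^I` given by an `I × J` matrix of operators on `H`. -/
def blockOp (M : Matrix I J (H →L[ℂ] H)) : HPow J H →L[ℂ] HPow I H :=
  ∑ i, ∑ j, blockIncl i ∘L M i j ∘L blockProj j

theorem blockOp_apply (M : Matrix I J (H →L[ℂ] H)) (x : HPow J H) (i : I) :
    blockOp M x i = ∑ j, M i j (x j) := by
  rw [blockOp, ← blockProj_apply]
  simp only [sum_apply, map_sum, comp_apply]
  simp only [blockProj_apply, blockIncl_apply]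
  simp

theorem blockOp_mul (M : Matrix I J (H →L[ℂ] H)) (N : Matrix J K (H →L[ℂ] H)) :
    blockOp (M * N) = blockOp M ∘L blockOp N := by
  ext x i
  simp only [comp_apply, blockOp_apply, Matrix.mul_apply, sum_apply, map_sum]
  exact Finset.sum_comm

theorem blockOp_one : blockOp (1 : Matrix J J (H →L[ℂ] H)) = 1 := by
  ext x i
  simp only [blockOp_apply, Matrix.one_apply, one_apply_eq_self]
  rw [Finset.sum_eq_single i] <;> simp +contextual [eq_comm]

theorem blockOp_zero : blockOp (0 : Matrix I J (H →L[ℂ] H)) = 0 := by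
  simp [blockOp]

theorem blockOp_add (M N : Matrix I J (H →L[ℂ] H)) :
    blockOp (M + N) = blockOp M + blockOp N := by
  ext x i
  simp [blockOp_apply, Finset.sum_add_distrib]

theorem blockOp_sub (M N : Matrix I J (H →L[ℂ] H)) :
    blockOp (M - N) = blockOp M - blockOp N := by
  ext x i
  simp [blockOp_apply, Finset.sum_sub_distrib]

theorem isIdempotentElem_blockOp {M : Matrix J J (H →L[ℂ] H)} (hM : IsIdempotentElem M) :
    IsIdempotentElem (blockOp M) := by
  change blockOp M ∘L blockOp M = blockOp M
  rw [← blockOp_mul, hM]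

theorem blockOp_mem_approximable {M : Matrix I J (H →L[ℂ] H)}
    (hM : ∀ i j, M i j ∈ approximable H H) :
    blockOp M ∈ approximable (HPow J H) (HPow I H) :=
  Submodule.sum_mem _ fun i _ => Submodule.sum_mem _ fun j _ =>
    comp_mem_approximable _ (mem_approximable_comp (hM i j) _)

theorem blockOp_mem_nuclear {M : Matrix I J (H →L[ℂ] H)} (hM : ∀ i j, M i j ∈ nuclear H H) :
    blockOp M ∈ nuclear (HPow J H) (HPow I H) :=
  Submodule.sum_mem _ fun i _ => Submodule.sum_mem _ fun j _ =>
    comp_mem_nuclear _ (mem_nuclear_comp (hM i j) _)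

/-- By cyclicity the block `(i, j)` has the trace of `M i j` composed with `blockProj j ∘L blockIncl
i`, which is `1` on the diagonal and `0` off it. -/
theorem ntr_blockOp {M : Matrix J J (H →L[ℂ] H)} (hM : ∀ i j, M i j ∈ nuclear H H) :
    ntr (blockOp M) = ntr M.trace := by
  have h : ∀ i j : J, blockIncl i ∘L M i j ∘L blockProj j ∈ nuclear (HPow J H) (HPow J H) :=
    fun i j => comp_mem_nuclear _ (mem_nuclear_comp (hM i j) _)
  have h0 : ∀ i j : J, ntr (blockIncl i ∘L M i j ∘L blockProj j) =
      if i = j then ntr (M i j) else 0 := by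
    intro i j
    rw [ntr_comp_comm (mem_nuclear_comp (hM i j) _), comp_assoc]
    have hji : (blockProj j ∘L blockIncl i : H →L[ℂ] H) = if i = j then 1 else 0 := by
      ext x
      rw [comp_apply, blockProj_apply, blockIncl_apply]
      split_ifs with h1 h2 h2
      · rfl
      · exact absurd h1.symm h2
      · exact absurd h2.symm h1
      · rfl
    rw [hji]
    split_ifs with h1
    · rfl
    · rw [comp_zero, ntr_zero]
  rw [blockOp, ntr_sum _ _ fun i => Submodule.sum_mem _ fun j _ => h i j, Matrix.trace,
    ntr_sum _ (fun i => M.diag i) fun i => hM i i]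
  refine Finset.sum_congr rfl fun i _ => ?_
  rw [ntr_sum _ _ fun j => h i j]
  simp [h0]

end Block

/-! ## Extension to the enveloping C*-algebra -/

section Extension

/-- The pullback of the norm of `D` is a C*-seminorm, so it is dominated by `‖ι b‖` and `φ` extends
by continuity from the dense range. Multiplicativity passes to the limit; only the continuous ring
homomorphism is needed later. -/
theorem IsCStarEnvelope.exists_extension {B : Type*} [Ring B] [StarRing B] [Algebra ℂ B]
    {C : Type*} [CStarAlgebra C] {ι : B →⋆ₐ[ℂ] C} (hι : IsCStarEnvelope ι)
    {D : Type*} [NormedRing D] [StarRing D] [CStarRing D] [NormedAlgebra ℂ D] [CompleteSpace D]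
    (φ : B →⋆ₐ[ℂ] D) : ∃ ψ : C →+* D, Continuous ψ ∧ ∀ b, ψ (ι b) = φ b := by
  let f : B →ₗ[ℂ] D := (φ : B →ₐ[ℂ] D).toLinearMap
  let e : B →ₗ[ℂ] C := (ι : B →ₐ[ℂ] C).toLinearMap
  have hf : ∃ K, ∀ b, ‖f b‖ ≤ K * ‖e b‖ := by
    refine ⟨1, fun b => ?_⟩
    rw [one_mul]
    refine hι.le_norm ((normSeminorm ℂ D).comp f) ⟨fun a b => ?_, fun a => ?_⟩ b
    · change ‖φ (a * b)‖ ≤ ‖φ a‖ * ‖φ b‖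
      rw [map_mul]
      exact norm_mul_le _ _
    · change ‖φ (star a * a)‖ = ‖φ a‖ ^ 2
      rw [map_mul, map_star, CStarRing.norm_star_mul_self, sq]
  have he : DenseRange e := hι.dense
  let g : C →L[ℂ] D := f.extendOfNorm e
  have hg : ∀ b, g (ι b) = φ b := fun b => LinearMap.extendOfNorm_eq he hf b
  refine ⟨{ toFun := g, map_one' := ?_, map_mul' := ?_, map_zero' := map_zero g,
            map_add' := map_add g }, g.continuous, hg⟩
  · rw [← map_one ι, hg, map_one]
  · intro x y
    refine hι.dense.induction_on₂ (p := fun x y => g (x * y) = g x * g y)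
      (isClosed_eq (by fun_prop) (by fun_prop)) (fun a b => ?_) x y
    rw [← map_mul, hg, hg, hg, map_mul]

end Extension

/-! ## Homomorphisms out of `K_0` -/

section K0

/-- The universal property of `K_0`. -/
def K0.lift {R G : Type*} [Ring R] [AddCommGroup G] (f : Idem R → G)
    (heq : ∀ p q : Idem R, p.Equivalent q → f p = f q)
    (hsum : ∀ p q : Idem R, f (p.sum q) = f p + f q) : K0 R →+ G :=
  QuotientAddGroup.lift _ (FreeAbelianGroup.lift f) ((AddSubgroup.closure_le _).2 (by
    rintro _ (⟨p, q, h, rfl⟩ | ⟨p, q, rfl⟩)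
    · simp [heq p q h]
    · simp [hsum p q]))

theorem K0.lift_mk {R G : Type*} [Ring R] [AddCommGroup G] (f : Idem R → G) (heq hsum) {n : ℕ}
    (p : Matrix (Fin n) (Fin n) R) (hp : IsIdempotentElem p) :
    K0.lift f heq hsum (K0.mk p hp) = f ⟨n, p, hp⟩ :=
  FreeAbelianGroup.lift_apply_of _ _

theorem K0.mk_eq_of_equivalent {R : Type*} [Ring R] {p q : Idem R} (h : p.Equivalent q) :
    K0.mk p.2.1 p.2.2 = K0.mk q.2.1 q.2.2 := by
  refine (QuotientAddGroup.eq_iff_sub_mem).2 (AddSubgroup.subset_closure (Or.inl ⟨p, q, h, rfl⟩))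

theorem exists_trace_eq_intCast {n : ℕ} {p : Matrix (Fin n) (Fin n) ℂ}
    (hp : IsIdempotentElem p) : ∃ k : ℤ, p.trace = k := by
  have : IsIdempotentElem (Matrix.toLin' p) := by
    change Matrix.toLin' p * Matrix.toLin' p = Matrix.toLin' p
    rw [Module.End.mul_eq_comp, ← Matrix.toLin'_mul, hp]
  obtain ⟨k, hk⟩ := exists_trace_eq_natCast this
  exact ⟨k, by rw [← Matrix.trace_toLin'_eq, hk]; simp⟩

theorem trace_sum {R : Type*} [Ring R] (p q : Idem R) :
    (p.sum q).2.1.trace = p.2.1.trace + q.2.1.trace := by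
  have h : (p.sum q).2.1.trace = (Matrix.fromBlocks p.2.1 0 0 q.2.1).trace := by
    refine (Fintype.sum_equiv finSumFinEquiv _ _ fun i => ?_).symm
    change _ = Matrix.fromBlocks p.2.1 0 0 q.2.1 (finSumFinEquiv.symm (finSumFinEquiv i))
      (finSumFinEquiv.symm (finSumFinEquiv i))
    rw [Equiv.symm_apply_apply]
    rfl
  rw [h]
  simp [Matrix.trace]

variable {C : Type*} [Ring C]

/-- The rank homomorphism on `K_0` induced by a character. -/
theorem exists_K0_trace (χ : C →+* ℂ) : ∃ f : K0 C →+ ℤ,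
    ∀ (n : ℕ) (p : Matrix (Fin n) (Fin n) C) (hp : IsIdempotentElem p),
      (f (K0.mk p hp) : ℂ) = χ p.trace := by
  have h : ∀ p : Idem C, ∃ k : ℤ, χ p.2.1.trace = k := fun p => by
    obtain ⟨k, hk⟩ := exists_trace_eq_intCast (isIdempotentElem_map χ p.2.2)
    exact ⟨k, by rw [← hk, AddMonoidHom.map_trace χ]⟩
  choose f hf using h
  refine ⟨K0.lift f (fun p q hpq => ?_) (fun p q => ?_), fun n p hp => ?_⟩
  · obtain ⟨x, y, h1, h2⟩ := hpq
    have : χ p.2.1.trace = χ q.2.1.trace := by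
      rw [AddMonoidHom.map_trace χ, AddMonoidHom.map_trace χ, h1, h2]
      rw [Matrix.map_mul, Matrix.map_mul, Matrix.trace_mul_comm]
    rw [hf, hf] at this
    exact_mod_cast this
  · have : χ (p.sum q).2.1.trace = χ p.2.1.trace + χ q.2.1.trace := by
      rw [trace_sum, map_add]
    rw [hf, hf, hf] at this
    exact_mod_cast this
  · rw [K0.lift_mk, hf ⟨n, p, hp⟩]

open ContinuousLinearMap

variable {H : Type w} [NormedAddCommGroup H] [InnerProductSpace ℂ H] [CompleteSpace H]

/-! ### Block sums written through inclusion and projection matrices. -/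

section BlockMatrices

variable (R : Type*) [Ring R] (m n : ℕ)

/-- The inclusion of `R^m` into `R^(m + n)` as a matrix. -/
def inclLeft : Matrix (Fin (m + n)) (Fin m) R :=
  Matrix.submatrix (Matrix.fromRows (1 : Matrix (Fin m) (Fin m) R) (0 : Matrix (Fin n) (Fin m) R))
    finSumFinEquiv.symm id

/-- The inclusion of `R^n` into `R^(m + n)` as a matrix. -/
def inclRight : Matrix (Fin (m + n)) (Fin n) R :=
  Matrix.submatrix (Matrix.fromRows (0 : Matrix (Fin m) (Fin n) R) (1 : Matrix (Fin n) (Fin n) R))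
    finSumFinEquiv.symm id

/-- The projection of `R^(m + n)` onto `R^m` as a matrix. -/
def projLeft : Matrix (Fin m) (Fin (m + n)) R :=
  Matrix.submatrix (Matrix.fromCols (1 : Matrix (Fin m) (Fin m) R) (0 : Matrix (Fin m) (Fin n) R))
    id finSumFinEquiv.symm

/-- The projection of `R^(m + n)` onto `R^n` as a matrix. -/
def projRight : Matrix (Fin n) (Fin (m + n)) R :=
  Matrix.submatrix (Matrix.fromCols (0 : Matrix (Fin n) (Fin m) R) (1 : Matrix (Fin n) (Fin n) R))
    id finSumFinEquiv.symm

theorem projLeft_mul_inclLeft : projLeft R m n * inclLeft R m n = 1 := by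
  rw [projLeft, inclLeft, Matrix.submatrix_mul_equiv, Matrix.fromCols_mul_fromRows]
  simp

theorem projRight_mul_inclRight : projRight R m n * inclRight R m n = 1 := by
  rw [projRight, inclRight, Matrix.submatrix_mul_equiv, Matrix.fromCols_mul_fromRows]
  simp

theorem projLeft_mul_inclRight : projLeft R m n * inclRight R m n = 0 := by
  rw [projLeft, inclRight, Matrix.submatrix_mul_equiv, Matrix.fromCols_mul_fromRows]
  simp

theorem projRight_mul_inclLeft : projRight R m n * inclLeft R m n = 0 := by
  rw [projRight, inclLeft, Matrix.submatrix_mul_equiv, Matrix.fromCols_mul_fromRows]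
  simp

variable {R m n} in
-- Brings the sum in `Idem` into the form `i p r + i' q r'` to which `relIndex_directSum` applies.
theorem fromBlocks_submatrix_eq (p : Matrix (Fin m) (Fin m) R) (q : Matrix (Fin n) (Fin n) R) :
    (Matrix.fromBlocks p 0 0 q).submatrix finSumFinEquiv.symm finSumFinEquiv.symm =
      inclLeft R m n * p * projLeft R m n + inclRight R m n * q * projRight R m n := by
  have h : Matrix.fromBlocks p 0 0 q =
      Matrix.fromRows (1 : Matrix (Fin m) (Fin m) R) (0 : Matrix (Fin n) (Fin m) R) * p *
          Matrix.fromCols (1 : Matrix (Fin m) (Fin m) R) (0 : Matrix (Fin m) (Fin n) R) +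
        Matrix.fromRows (0 : Matrix (Fin m) (Fin n) R) (1 : Matrix (Fin n) (Fin n) R) * q *
          Matrix.fromCols (0 : Matrix (Fin n) (Fin m) R) (1 : Matrix (Fin n) (Fin n) R) := by
    ext (i | i) (j | j) <;> simp [Matrix.fromRows_mul]
  rw [h]
  rfl

end BlockMatrices

theorem sum_map_eq {R : Type*} [Ring R] (f : C →+* R) (p q : Idem C) :
    (p.sum q).2.1.map f =
      inclLeft R p.1 q.1 * p.2.1.map f * projLeft R p.1 q.1 +
        inclRight R p.1 q.1 * q.2.1.map f * projRight R p.1 q.1 := by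
  rw [← fromBlocks_submatrix_eq]
  change ((Matrix.fromBlocks p.2.1 0 0 q.2.1).map f).submatrix _ _ = _
  rw [Matrix.fromBlocks_map, Matrix.map_zero _ (map_zero f), Matrix.map_zero _ (map_zero f)]
  rfl

theorem blockOp_sum_map (f : C →+* (H →L[ℂ] H)) (p q : Idem C) :
    blockOp (I := Fin (p.1 + q.1)) (J := Fin (p.1 + q.1)) ((p.sum q).2.1.map f) =
      blockOp (inclLeft _ p.1 q.1) ∘L blockOp (p.2.1.map f) ∘L blockOp (projLeft _ p.1 q.1) +
        blockOp (inclRight _ p.1 q.1) ∘L blockOp (q.2.1.map f) ∘L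
          blockOp (projRight _ p.1 q.1) := by
  refine (congrArg (blockOp (I := Fin (p.1 + q.1)) (J := Fin (p.1 + q.1)))
    (sum_map_eq f p q)).trans ?_
  rw [blockOp_add, blockOp_mul, blockOp_mul, blockOp_mul, blockOp_mul, comp_assoc, comp_assoc]

/-- The index homomorphism on `K_0` induced by two representations that agree up to approximable
operators. -/
theorem exists_K0_index (ρ σ : C →+* (H →L[ℂ] H)) (h : ∀ c, ρ c - σ c ∈ approximable H H) :
    ∃ f : K0 C →+ ℤ, ∀ (n : ℕ) (p : Matrix (Fin n) (Fin n) C) (hp : IsIdempotentElem p),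
      f (K0.mk p hp) = relIndex (blockOp (p.map ρ)) (blockOp (p.map σ)) := by
  have idem : ∀ (τ : C →+* (H →L[ℂ] H)) (p : Idem C), IsIdempotentElem (blockOp (p.2.1.map τ)) :=
    fun τ p => isIdempotentElem_blockOp (isIdempotentElem_map τ p.2.2)
  have appr : ∀ {m n : ℕ} (p : Matrix (Fin m) (Fin n) C),
      blockOp (p.map ρ) - blockOp (p.map σ) ∈ approximable _ _ := by
    intro m n p
    rw [← blockOp_sub]
    exact blockOp_mem_approximable fun i j => h (p i j)
  refine ⟨K0.lift (fun p => relIndex (blockOp (p.2.1.map ρ)) (blockOp (p.2.1.map σ)))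
    (fun p q hpq => ?_) (fun p q => ?_), fun n p hp => K0.lift_mk _ _ _ p hp⟩
  · obtain ⟨x, y, h1, h2⟩ := hpq
    -- The matrices realizing the equivalence over `C` become intertwiners under `ρ` and under `σ`,
    -- and these two versions agree up to approximable entries.
    refine PairEquiv.relIndex_eq (idem ρ p) (idem σ p) (idem ρ q) (idem σ q) (appr _) (appr _)
      ⟨blockOp (x.map ρ), blockOp (x.map σ), blockOp (y.map ρ), blockOp (y.map σ), appr _, appr _,
        ?_, ?_, ?_, ?_⟩
    · rw [← blockOp_mul, ← Matrix.map_mul, h1]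
    · rw [← blockOp_mul, ← Matrix.map_mul, h2]
    · rw [← blockOp_mul, ← Matrix.map_mul, h1]
    · rw [← blockOp_mul, ← Matrix.map_mul, h2]
  · refine (congrArg₂ (relIndex (E := HPow (Fin (p.1 + q.1)) H)) (blockOp_sum_map ρ p q)
      (blockOp_sum_map σ p q)).trans ?_
    refine relIndex_directSum (idem ρ p) (idem σ p) (idem ρ q) (idem σ q) (appr _) (appr _)
      ?_ ?_ ?_ ?_
    · rw [← blockOp_mul, projLeft_mul_inclLeft, blockOp_one]
    · rw [← blockOp_mul, projRight_mul_inclRight, blockOp_one]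
    · rw [← blockOp_mul, projLeft_mul_inclRight, blockOp_zero]
    · rw [← blockOp_mul, projRight_mul_inclLeft, blockOp_zero]

end K0

/-! ## Idempotent matrices representing a right module -/

section Represents

set_option linter.unusedSectionVars false

variable {R : Type*} [Ring R] {I J K : Type} [Fintype I] [Fintype J] [Fintype K]
  [DecidableEq I] [DecidableEq J] [DecidableEq K]
variable {E F : Type*} [AddCommGroup E] [Module Rᵐᵒᵖ E] [AddCommGroup F] [Module Rᵐᵒᵖ F]

theorem sum_op_smul_map_single (f : (J → R) →ₗ[Rᵐᵒᵖ] E) (x : J → R) :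
    f x = ∑ j, op (x j) • f (Pi.single j 1) := by
  conv_lhs => rw [← Finset.univ_sum_single x, map_sum]
  refine Finset.sum_congr rfl fun j _ => ?_
  rw [← map_smul, ← Pi.single_smul', op_smul_eq_mul, one_mul]

/-- The matrix of a right linear map between free right modules. -/
def rightMatrix (f : (J → R) →ₗ[Rᵐᵒᵖ] (I → R)) : Matrix I J R :=
  Matrix.of fun i j => f (Pi.single j 1) i

theorem rightMatrix_mulVec (f : (J → R) →ₗ[Rᵐᵒᵖ] (I → R)) (x : J → R) :
    (rightMatrix f).mulVec x = f x := by
  rw [sum_op_smul_map_single f x]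
  funext i
  simp [Matrix.mulVec, dotProduct, rightMatrix]

theorem rightMatrix_comp (g : (J → R) →ₗ[Rᵐᵒᵖ] (I → R)) (f : (K → R) →ₗ[Rᵐᵒᵖ] (J → R)) :
    rightMatrix (g ∘ₗ f) = rightMatrix g * rightMatrix f := by
  ext i k
  change g (f (Pi.single k 1)) i = _
  rw [← rightMatrix_mulVec g]
  rfl

theorem rightMatrix_id : rightMatrix (LinearMap.id : (J → R) →ₗ[Rᵐᵒᵖ] (J → R)) = 1 := by
  ext i j
  simp [rightMatrix, Matrix.one_apply, Pi.single_apply]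

/-- Left multiplication by a matrix, as a map of right modules. -/
def mulVecRight (p : Matrix I J R) : (J → R) →ₗ[Rᵐᵒᵖ] (I → R) where
  toFun := p.mulVec
  map_add' := Matrix.mulVec_add p
  map_smul' c x := Matrix.mulVec_smul p c x

theorem rightMatrix_mulVecRight (p : Matrix I J R) : rightMatrix (mulVecRight p) = p := by
  ext i j
  simp [rightMatrix, mulVecRight]

/-- The right module `E` is isomorphic to `p R^J`: it is a retract of `R^J` and the corresponding
projection of `R^J` is `p`. -/
def Represents (E : Type*) [AddCommGroup E] [Module Rᵐᵒᵖ E] (p : Matrix J J R) : Prop :=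
  ∃ (ψ : E →ₗ[Rᵐᵒᵖ] (J → R)) (ξ : (J → R) →ₗ[Rᵐᵒᵖ] E),
    ξ ∘ₗ ψ = LinearMap.id ∧ rightMatrix (ψ ∘ₗ ξ) = p

theorem Represents.isIdempotentElem {p : Matrix J J R} (h : Represents E p) :
    IsIdempotentElem p := by
  obtain ⟨ψ, ξ, h, rfl⟩ := h
  rw [IsIdempotentElem, ← rightMatrix_comp]
  congr 1
  rw [LinearMap.comp_assoc, ← LinearMap.comp_assoc ξ, h, LinearMap.id_comp]

/-- Each free module is mapped to the other through `E`. Hence the class of a representing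
idempotent in `K_0` depends only on the module. -/
theorem Represents.exists_mul_eq {p : Matrix I I R} {q : Matrix J J R} (hp : Represents E p)
    (hq : Represents E q) : ∃ (x : Matrix I J R) (y : Matrix J I R), p = x * y ∧ q = y * x := by
  obtain ⟨ψ, ξ, h, rfl⟩ := hp
  obtain ⟨ψ', ξ', h', rfl⟩ := hq
  refine ⟨rightMatrix (ψ ∘ₗ ξ'), rightMatrix (ψ' ∘ₗ ξ), ?_, ?_⟩
  · rw [← rightMatrix_comp, LinearMap.comp_assoc, ← LinearMap.comp_assoc ξ, h',
      LinearMap.id_comp]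
  · rw [← rightMatrix_comp, LinearMap.comp_assoc, ← LinearMap.comp_assoc ξ', h,
      LinearMap.id_comp]

theorem Represents.of_equiv {p : Matrix J J R} (hp : Represents E p) (e : E ≃ₗ[Rᵐᵒᵖ] F) :
    Represents F p := by
  obtain ⟨ψ, ξ, h, rfl⟩ := hp
  refine ⟨ψ ∘ₗ e.symm.toLinearMap, e.toLinearMap ∘ₗ ξ, ?_, ?_⟩
  · ext x
    have := LinearMap.congr_fun h (e.symm x)
    simpa using congrArg e this
  · congr 1
    refine LinearMap.ext fun x => ?_
    simp

theorem Represents.reindex {p : Matrix J J R} (hp : Represents E p) (e : J ≃ K) :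
    Represents E (p.submatrix e.symm e.symm) := by
  obtain ⟨ψ, ξ, h, rfl⟩ := hp
  refine ⟨LinearMap.funLeft Rᵐᵒᵖ R e.symm ∘ₗ ψ, ξ ∘ₗ LinearMap.funLeft Rᵐᵒᵖ R e, ?_, ?_⟩
  · rw [← h]
    ext x
    have : (ψ x ∘ e.symm) ∘ e = ψ x := by ext; simp
    simp [LinearMap.funLeft, this]
  · ext i j
    have : (Pi.single j 1 : K → R) ∘ e = Pi.single (e.symm j) 1 := by
      ext k
      simp [Pi.single_apply, Equiv.eq_symm_apply]
    simp [rightMatrix, LinearMap.funLeft, this]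

theorem represents_of_equiv_idemModule {n : ℕ} {p : Matrix (Fin n) (Fin n) R}
    (hp : IsIdempotentElem p) (e : E ≃ₗ[Rᵐᵒᵖ] idemModule p) : Represents E p := by
  refine Represents.of_equiv ?_ e.symm
  refine ⟨(idemModule p).subtype, (mulVecRight p).codRestrict (idemModule p) fun y => ⟨y, rfl⟩,
    ?_, rightMatrix_mulVecRight p⟩
  ext ⟨_, y, rfl⟩ : 1
  refine Subtype.ext ?_
  change p.mulVec (p.mulVec y) = p.mulVec y
  rw [Matrix.mulVec_mulVec, hp]

theorem exists_represents [Module.Finite Rᵐᵒᵖ E] [Module.Projective Rᵐᵒᵖ E] :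
    ∃ (n : ℕ) (p : Matrix (Fin n) (Fin n) R), Represents E p := by
  -- Finite generation supplies free modules over `Rᵐᵒᵖ`, whereas matrices act on columns over `R`;
  -- the two agree as right modules.
  let e : R ≃ₗ[Rᵐᵒᵖ] Rᵐᵒᵖ :=
    { toFun := op, invFun := unop, left_inv := fun _ => rfl, right_inv := fun _ => rfl
      map_add' := fun _ _ => rfl, map_smul' := fun _ _ => rfl }
  obtain ⟨n, s, hs⟩ := Module.Finite.exists_fin' Rᵐᵒᵖ E
  obtain ⟨i, hi⟩ := Module.projective_lifting_property s LinearMap.id hs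
  let e' : (Fin n → R) ≃ₗ[Rᵐᵒᵖ] (Fin n → Rᵐᵒᵖ) := LinearEquiv.piCongrRight fun _ => e
  refine ⟨n, _, e'.symm.toLinearMap ∘ₗ i, s ∘ₗ e'.toLinearMap, ?_, rfl⟩
  rw [← hi]
  ext x
  simp

theorem represents_punit : Represents (R := R) PUnit.{u + 1} (0 : Matrix (Fin 0) (Fin 0) R) :=
  ⟨0, 0, Subsingleton.elim _ _, Subsingleton.elim _ _⟩

theorem represents_self : Represents R (1 : Matrix (Fin 1) (Fin 1) R) := by
  let e : (Fin 1 → R) ≃ₗ[Rᵐᵒᵖ] R := LinearEquiv.funUnique (Fin 1) Rᵐᵒᵖ R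
  refine ⟨e.symm.toLinearMap, e.toLinearMap, ?_, ?_⟩
  · ext
    simp
  · rw [← rightMatrix_id]
    congr 1
    refine LinearMap.ext fun x => ?_
    simp

theorem Represents.prod {p : Matrix I I R} {q : Matrix J J R} (hp : Represents E p)
    (hq : Represents F q) : Represents (E × F) (Matrix.fromBlocks p 0 0 q) := by
  obtain ⟨ψ, ξ, h, rfl⟩ := hp
  obtain ⟨ψ', ξ', h', rfl⟩ := hq
  let e : (I ⊕ J → R) ≃ₗ[Rᵐᵒᵖ] (I → R) × (J → R) := LinearEquiv.sumArrowLequivProdArrow I J Rᵐᵒᵖ R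
  refine ⟨e.symm.toLinearMap ∘ₗ ψ.prodMap ψ', ξ.prodMap ξ' ∘ₗ e.toLinearMap, ?_, ?_⟩
  · refine LinearMap.ext fun x => ?_
    exact (congrArg (ξ.prodMap ξ') (e.apply_symm_apply _)).trans
      (Prod.ext (LinearMap.congr_fun h x.1) (LinearMap.congr_fun h' x.2))
  · have h1 : ∀ k, e (Pi.single (Sum.inl k) 1) = (Pi.single k 1, 0) := by
      intro k
      refine Prod.ext (funext fun l => ?_) (funext fun l => ?_)
      · simp [e, Pi.single_apply]
      · simp [e]
    have h2 : ∀ k, e (Pi.single (Sum.inr k) 1) = (0, Pi.single k 1) := by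
      intro k
      refine Prod.ext (funext fun l => ?_) (funext fun l => ?_)
      · simp [e]
      · simp [e, Pi.single_apply]
    ext (i | i) (j | j) <;> simp [rightMatrix, h1, h2, e]

end Represents

/-! ## Tensor products and trivializations -/

section TensorRepresents

set_option linter.unusedSectionVars false

variable {R : Type*} [Ring R] {J K : Type} [Fintype J] [Fintype K]
  [DecidableEq J] [DecidableEq K]
variable {E F : Type*} [AddCommGroup E] [Module Rᵐᵒᵖ E]
  [AddCommGroup F] [Module R F] [Module Rᵐᵒᵖ F] [SMulCommClass R Rᵐᵒᵖ F]

variable (F) in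
/-- The left action on a bimodule, by right linear maps. -/
def leftMul (b : R) : F →ₗ[Rᵐᵒᵖ] F where
  toFun f := b • f
  map_add' := smul_add b
  map_smul' c f := smul_comm b c f

/-- The matrix over `R` describing the left action on a bimodule that is a retract of `R^K` as a
right module. -/
def actionMatrix (η : F →ₗ[Rᵐᵒᵖ] (K → R)) (ζ : (K → R) →ₗ[Rᵐᵒᵖ] F) (b : R) : Matrix K K R :=
  rightMatrix (η ∘ₗ leftMul F b ∘ₗ ζ)

theorem actionMatrix_one (η : F →ₗ[Rᵐᵒᵖ] (K → R)) (ζ : (K → R) →ₗ[Rᵐᵒᵖ] F) :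
    actionMatrix η ζ 1 = rightMatrix (η ∘ₗ ζ) := by
  have : leftMul F (1 : R) = LinearMap.id := by ext f; exact one_smul R f
  rw [actionMatrix, this, LinearMap.id_comp]

/-- A retraction of `R^J` onto `E` makes `E ⊗ F` a retract of `F^J`, which is a retract of `R^(J ×
K)`. The resulting projection has as its `(i, j)` block the action of `p_ij` on `F`. -/
theorem Represents.tensor {p : Matrix J J R} (hp : Represents E p)
    (η : F →ₗ[Rᵐᵒᵖ] (K → R)) (ζ : (K → R) →ₗ[Rᵐᵒᵖ] F) (hζη : ζ ∘ₗ η = LinearMap.id) :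
    Represents (BalTensor R E F)
      (Matrix.of fun x y : J × K => actionMatrix η ζ (p x.1 y.1) x.2 y.2) := by
  obtain ⟨ψ, ξ, h, rfl⟩ := hp
  let a : BalTensor R E F →ₗ[Rᵐᵒᵖ] (J × K → R) :=
    { toFun := BalTensor.lift (fun (e : E) (f : F) => fun x : J × K => η (ψ e x.1 • f) x.2)
        (fun e e' f => by funext x; simp [add_smul])
        (fun e f f' => by funext x; simp)
        (fun b e f => by funext x; simp [mul_smul])
      map_add' := map_add _
      map_smul' := fun t x => by
        induction x using BalTensor.induction with
        | ht e f =>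
          funext x
          change η (ψ e x.1 • t • f) x.2 = (t • η (ψ e x.1 • f)) x.2
          rw [smul_comm, map_smul]
        | ha x y hx hy => rw [smul_add, map_add, hx, hy, map_add, smul_add] }
  let c : (J × K → R) →ₗ[Rᵐᵒᵖ] BalTensor R E F :=
    { toFun := fun x => ∑ j, BalTensor.tmul R (ξ (Pi.single j 1)) (ζ fun k => x (j, k))
      map_add' := fun x y => by
        rw [← Finset.sum_add_distrib]
        refine Finset.sum_congr rfl fun j _ => ?_
        rw [← BalTensor.tmul_add, ← map_add]
        rfl
      map_smul' := fun t x => by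
        rw [RingHom.id_apply, Finset.smul_sum]
        refine Finset.sum_congr rfl fun j _ => ?_
        rw [BalTensor.rsmul_tmul, ← map_smul]
        rfl }
  have ha : ∀ e f x, a (BalTensor.tmul R e f) x = η (ψ e x.1 • f) x.2 := fun _ _ _ => rfl
  have hc : ∀ x, c x = ∑ j, BalTensor.tmul R (ξ (Pi.single j 1)) (ζ fun k => x (j, k)) :=
    fun _ => rfl
  refine ⟨a, c, ?_, ?_⟩
  · ext x
    induction x using BalTensor.induction with
    | ht e f =>
      change c (a (BalTensor.tmul R e f)) = BalTensor.tmul R e f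
      rw [hc]
      have h1 : ∀ j, BalTensor.tmul R (ξ (Pi.single j 1))
          (ζ fun k => a (BalTensor.tmul R e f) (j, k)) =
          BalTensor.tmul R (op (ψ e j) • ξ (Pi.single j 1)) f := by
        intro j
        rw [BalTensor.smul_tmul]
        exact congrArg _ (LinearMap.congr_fun hζη (ψ e j • f))
      simp only [h1]
      rw [← BalTensor.sum_tmul, ← sum_op_smul_map_single]
      exact congrArg (fun z => BalTensor.tmul R z f) (LinearMap.congr_fun h e)
    | ha x y hx hy => rw [map_add, hx, hy, map_add]
  · ext ⟨i, k⟩ ⟨j, l⟩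
    change a (c (Pi.single (j, l) 1)) (i, k) = η (ψ (ξ (Pi.single j 1)) i • ζ (Pi.single l 1)) k
    have h1 : ∀ j' : J, (fun k' => (Pi.single (j, l) 1 : J × K → R) (j', k')) =
        if j' = j then Pi.single l 1 else 0 := by
      intro j'
      funext k'
      split_ifs with hj
      · subst hj
        simp [Pi.single_apply]
      · simp [hj]
    rw [hc, Finset.sum_eq_single j]
    · rw [h1, if_pos rfl, ha]
    · intro j' _ hj
      rw [h1, if_neg hj, map_zero, BalTensor.tmul_zero]
    · simp

/-- The action matrix is additive in the acting element, so the diagonal blocks add up to the action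
of `Tr p`. The first factor thus enters only through its trace. -/
theorem trace_tensor (η : F →ₗ[Rᵐᵒᵖ] (K → R)) (ζ : (K → R) →ₗ[Rᵐᵒᵖ] F) (p : Matrix J J R) :
    (Matrix.of fun x y : J × K => actionMatrix η ζ (p x.1 y.1) x.2 y.2).trace =
      (actionMatrix η ζ p.trace).trace := by
  have h : ∀ k, actionMatrix η ζ p.trace k k = ∑ j, actionMatrix η ζ (p j j) k k := by
    intro k
    change η ((∑ j, p j j) • ζ (Pi.single k 1)) k = _
    rw [Finset.sum_smul, map_sum, Finset.sum_apply]
    rfl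
  simp only [Matrix.trace, Matrix.diag, Matrix.of_apply] at h ⊢
  simp only [h]
  rw [Fintype.sum_prod_type]
  exact Finset.sum_comm

/-- A trivialization over `A` of a bimodule over `B ⊆ A` turns the left action into the scalar one
up to matrices `u` and `v` over `A` with `v u = 1`. -/
theorem exists_matrices_of_trivializes {A : Type*} [Ring A] [StarRing A] [Algebra ℂ A]
    [StarModule ℂ A] (B : StarSubalgebra ℂ A) {F : Type*} [AddCommGroup F] [Module B F]
    [Module Bᵐᵒᵖ F] [SMulCommClass B Bᵐᵒᵖ F] {r : ℕ}
    (Θ : BimodIso B A (BalTensor B F A) (Fin r → A))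
    (η : F →ₗ[Bᵐᵒᵖ] (K → B)) (ζ : (K → B) →ₗ[Bᵐᵒᵖ] F) (hζη : ζ ∘ₗ η = LinearMap.id) :
    ∃ (u : Matrix K (Fin r) A) (v : Matrix (Fin r) K A), v * u = 1 ∧
      ∀ (b : B) (k l : K), ((actionMatrix η ζ b k l : B) : A) = ∑ α, u k α * b * v α l := by
  -- This is `η ⊗ A`. The matrices below are those of `u = (η ⊗ A) Θ⁻¹` and `v = Θ (ζ ⊗ A)`.
  let ηA : BalTensor B F A →+ (K → A) :=
    BalTensor.lift (fun (f : F) (a : A) => fun k => (η f k : A) * a)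
      (fun f f' a => by funext k; simp [add_mul])
      (fun f a a' => by funext k; simp [mul_add])
      (fun b f a => by
        funext k
        rw [map_smul]
        change ((η f k * b : B) : A) * a = (η f k : A) * ((b : A) * a)
        rw [MulMemClass.coe_mul, mul_assoc])
  have hηA : ∀ f a k, ηA (BalTensor.tmul B f a) k = (η f k : A) * a := fun _ _ _ => rfl
  have hηA_smul : ∀ (a : Aᵐᵒᵖ) x, ηA (a • x) = a • ηA x := by
    intro a x
    induction x using BalTensor.induction with
    | ht f a' =>
      funext k
      change (η f k : A) * (a' * a.unop) = (η f k : A) * a' * a.unop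
      rw [mul_assoc]
    | ha x y hx hy => rw [smul_add, map_add, hx, hy, map_add, smul_add]
  let t : BalTensor B F A ≃+ (Fin r → A) := Θ.toAddEquiv
  have ht_left : ∀ (b : B) x, t (b • x) = b • t x := Θ.map_left
  have ht_right : ∀ (a : Aᵐᵒᵖ) x, t (a • x) = a • t x := Θ.map_right
  have ht_symm : ∀ (a : Aᵐᵒᵖ) y, t.symm (a • y) = a • t.symm y := by
    intro a y
    apply t.injective
    rw [ht_right, t.apply_symm_apply, t.apply_symm_apply]
  let u : Matrix K (Fin r) A := Matrix.of fun k α => ηA (t.symm (Pi.single α 1)) k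
  let v : Matrix (Fin r) K A := Matrix.of fun α l => t (BalTensor.tmul B (ζ (Pi.single l 1)) 1) α
  have hu : ∀ y, u.mulVec y = ηA (t.symm y) := by
    intro y
    conv_rhs => rw [← Finset.univ_sum_single y, map_sum, map_sum]
    funext k
    rw [Finset.sum_apply]
    change ∑ α, u k α * y α = _
    refine Finset.sum_congr rfl fun α _ => ?_
    have : (Pi.single α (y α) : Fin r → A) = op (y α) • Pi.single α 1 := by
      rw [← Pi.single_smul', op_smul_eq_mul, one_mul]
    rw [this, ht_symm, hηA_smul]
    rfl
  -- Since `ζ η = id`, applying `v` after `η ⊗ A` recovers `Θ`; together with `hu` this gives `v u =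
  -- Θ Θ⁻¹ = 1`.
  have hv : ∀ x, v.mulVec (ηA x) = t x := by
    intro x
    induction x using BalTensor.induction with
    | ht f a =>
      have h1 : BalTensor.tmul B f a =
          ∑ l, op ((η f l : A) * a) • BalTensor.tmul B (ζ (Pi.single l 1)) (1 : A) := by
        have hf : f = ∑ l, op (η f l) • ζ (Pi.single l 1) :=
          (LinearMap.congr_fun hζη f).symm.trans (sum_op_smul_map_single ζ (η f))
        conv_lhs => rw [hf, BalTensor.sum_tmul]
        refine Finset.sum_congr rfl fun l _ => ?_
        rw [BalTensor.smul_tmul, BalTensor.rsmul_tmul, op_smul_eq_mul, one_mul]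
        rfl
      conv_rhs => rw [h1, map_sum]
      funext α
      rw [Finset.sum_apply]
      change ∑ l, v α l * ((η f l : A) * a) = _
      refine Finset.sum_congr rfl fun l _ => ?_
      rw [ht_right]
      rfl
    | ha x y hx hy => rw [map_add, Matrix.mulVec_add, hx, hy, map_add]
  refine ⟨u, v, ?_, fun b k l => ?_⟩
  · ext α β
    have h1 : (v * u) α β = v.mulVec (u.mulVec (Pi.single β 1)) α := by
      rw [Matrix.mulVec_mulVec, Matrix.mulVec_single_one]
      rfl
    rw [h1, hu, hv, t.apply_symm_apply, Matrix.one_apply, Pi.single_apply]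
  -- Left linearity of `Θ` is used here: the action of `b` on `F ⊗ A` is scalar multiplication by
  -- `b` conjugated by `Θ`.
  · have h1 : ηA (t.symm (b • t (BalTensor.tmul B (ζ (Pi.single l 1)) 1))) k =
        ((actionMatrix η ζ b k l : B) : A) := by
      rw [← ht_left, t.symm_apply_apply, BalTensor.lsmul_tmul, hηA, mul_one]
      rfl
    rw [← h1, ← hu]
    change ∑ α, u k α * ((b : A) * v α l) = _
    exact Finset.sum_congr rfl fun α _ => (mul_assoc _ _ _).symm

end TensorRepresents

/-! ## The Chern character -/

section Chern

set_option linter.unusedSectionVars false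

variable {A : Type u} [Ring A] [StarRing A] [Algebra ℂ A] [StarModule ℂ A]
  {B : StarSubalgebra ℂ A} {C : Type v} [CStarAlgebra C]
  {H : Type w} [NormedAddCommGroup H] [InnerProductSpace ℂ H] [CompleteSpace H]

/-- The difference of `π` and the multiple `ε` of the identity representation. -/
def defect (ε : A →⋆ₐ[ℂ] ℂ) (π : A →⋆ₐ[ℂ] (H →L[ℂ] H)) (a : A) : H →L[ℂ] H :=
  π a - ε a • (1 : H →L[ℂ] H)

variable {ε : A →⋆ₐ[ℂ] ℂ} {π : A →⋆ₐ[ℂ] (H →L[ℂ] H)}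

theorem defect_add (a b : A) : defect ε π (a + b) = defect ε π a + defect ε π b := by
  simp only [defect, map_add, add_smul]
  abel

theorem defect_one : defect ε π 1 = 0 := by
  simp [defect]

theorem defect_zero : defect ε π 0 = 0 := by
  simp [defect]

/-- The homomorphism `K_0(C) → ℤ[t]/(t²)` of the Chern character. -/
theorem exists_K0_chern {ι : B →⋆ₐ[ℂ] C} (hι : IsCStarEnvelope ι)
    (hπ : ∀ b : B, defect ε π b ∈ nuclear H H) :
    ∃ chK : K0 C →+ DualNumber ℤ,
      ∀ (N : ℕ) (p : Matrix (Fin N) (Fin N) B) (hp : IsIdempotentElem p),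
        ((chK (K0.mk (p.map ι) (isIdempotentElem_map (ι : B →+* C) hp))).fst : ℂ) =
            ε (p.trace : A) ∧
          ((chK (K0.mk (p.map ι) (isIdempotentElem_map (ι : B →+* C) hp))).snd : ℂ) =
            ntr (defect ε π (p.trace : A)) := by
  obtain ⟨χ, hχc, hχ⟩ := hι.exists_extension (ε.comp B.subtype)
  obtain ⟨ρ, hρc, hρ⟩ := hι.exists_extension (π.comp B.subtype)
  let σ : C →+* (H →L[ℂ] H) := (algebraMap ℂ (H →L[ℂ] H)).comp χ
  have hσ : ∀ c, σ c = χ c • (1 : H →L[ℂ] H) := fun c =>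
    Algebra.algebraMap_eq_smul_one (A := H →L[ℂ] H) (χ c)
  have hdef : ∀ b : B, ρ (ι b) - σ (ι b) = defect ε π b := by
    intro b
    rw [hσ, hχ, hρ]
    rfl
  -- The approximable operators form a closed set, `ρ - σ` is continuous, and on the dense image of
  -- `B` it is nuclear.
  have happ : ∀ c, ρ c - σ c ∈ approximable H H := by
    intro c
    refine isClosed_property (p := fun c => ρ c - σ c ∈ approximable H H) hι.dense ?_ (fun b => ?_) c
    · refine (Submodule.isClosed_topologicalClosure _).preimage ?_
      simp only [hσ]
      fun_prop
    · rw [hdef]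
      exact nuclear_le_approximable (hπ b)
  obtain ⟨f₀, hf₀⟩ := exists_K0_trace χ
  obtain ⟨f₁, hf₁⟩ := exists_K0_index ρ σ happ
  refine ⟨AddMonoidHom.mk' (fun x => (f₀ x, f₁ x)) fun x y => ?_, fun N p hp => ⟨?_, ?_⟩⟩
  · rw [map_add, map_add]
    rfl
  · refine (hf₀ N _ _).trans ?_
    have : (p.map ι).trace = ι p.trace := (AddMonoidHom.map_trace ι p).symm
    rw [this, hχ]
    rfl
  · refine (congrArg (Int.cast : ℤ → ℂ) (hf₁ N _ (isIdempotentElem_map (ι : B →+* C) hp))).trans ?_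
    -- For matrices over `B` the difference of the two idempotents is the block operator of defects.
    -- It is nuclear, so the index is its trace, which is the trace of the defect of `Tr p`.
    have hsub : blockOp ((p.map ι).map ρ) - blockOp ((p.map ι).map σ) =
        blockOp (p.map fun b => defect ε π (b : A)) := by
      rw [← blockOp_sub]
      congr 1
      exact Matrix.ext fun i j => hdef (p i j)
    have hnuc := blockOp_mem_nuclear (M := p.map fun b => defect ε π (b : A)) fun i j => hπ (p i j)
    have hid : IsIdempotentElem (p.map ι) := isIdempotentElem_map (ι : B →+* C) hp
    change ((relIndex (blockOp ((p.map ι).map ρ)) (blockOp ((p.map ι).map σ)) : ℤ) : ℂ) = _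
    rw [← ntr_sub_eq_relIndex (isIdempotentElem_blockOp (isIdempotentElem_map ρ hid))
      (isIdempotentElem_blockOp (isIdempotentElem_map σ hid)) (by rw [hsub]; exact hnuc), hsub,
      ntr_blockOp (M := p.map fun b => defect ε π (b : A)) fun i j => hπ (p i j)]
    congr 1
    let g : B →+ (H →L[ℂ] H) := AddMonoidHom.mk' (fun b => defect ε π (b : A)) fun a b =>
      defect_add _ _
    exact (AddMonoidHom.map_trace g p).symm

/-- The values of `ε` and of the trace of the defect on `Tr (u b v)`, for matrices with `v u = 1`. -/
theorem trace_defect_conj {K : Type} [Fintype K] [DecidableEq K] {r : ℕ}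
    {u : Matrix K (Fin r) A} {v : Matrix (Fin r) K A} (hvu : v * u = 1)
    {b : A} (hb : defect ε π b ∈ nuclear H H)
    (h1 : defect ε π (∑ k, ∑ α, u k α * v α k) ∈ nuclear H H) :
    ε (∑ k, ∑ α, u k α * b * v α k) = ε b * r ∧
      ntr (defect ε π (∑ k, ∑ α, u k α * b * v α k)) =
        ε b * ntr (defect ε π (∑ k, ∑ α, u k α * v α k)) + r * ntr (defect ε π b) := by
  -- The order of the factors matters: this sum is `Tr (v u) = r`, while `Tr (u v)` is in general a
  -- different element of `A`.
  have hsum : ∑ k, ∑ α, v α k * u k α = (r : A) := by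
    rw [Finset.sum_comm]
    have : (v * u).trace = (r : A) := by rw [hvu, Matrix.trace_one, Fintype.card_fin]
    exact this
  have hε : ∀ b : A, ε (∑ k, ∑ α, u k α * b * v α k) = ε b * r := by
    intro b
    have h2 : ε (∑ k, ∑ α, v α k * u k α) = r := by rw [hsum, map_natCast]
    rw [← h2, map_sum, map_sum, Finset.mul_sum]
    refine Finset.sum_congr rfl fun k _ => ?_
    rw [map_sum, map_sum, Finset.mul_sum]
    refine Finset.sum_congr rfl fun α _ => ?_
    simp only [map_mul]
    ring
  refine ⟨hε b, ?_⟩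
  have hε1 : ε (∑ k, ∑ α, u k α * v α k) = r := by
    simpa using hε 1
  -- Substituting `π(b) = defect b + ε(b)` between `π(u)` and `π(v)`: the first part contains a
  -- nuclear factor, and the second reassembles to `ε(b)` times the defect of `Tr (u v)`.
  have hdec : defect ε π (∑ k, ∑ α, u k α * b * v α k) =
      (∑ k, ∑ α, π (u k α) * defect ε π b * π (v α k)) +
        ε b • defect ε π (∑ k, ∑ α, u k α * v α k) := by
    have h2 : ∑ k, ∑ α, π (u k α) * defect ε π b * π (v α k) =
        π (∑ k, ∑ α, u k α * b * v α k) - ε b • π (∑ k, ∑ α, u k α * v α k) := by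
      simp only [map_sum, map_mul, Finset.smul_sum, ← Finset.sum_sub_distrib]
      refine Finset.sum_congr rfl fun k _ => Finset.sum_congr rfl fun α _ => ?_
      rw [defect, mul_sub, sub_mul, mul_smul_comm, mul_one, smul_mul_assoc]
    rw [h2]
    simp only [defect, hε, hε1, smul_sub, smul_smul]
    abel
  have hnuc : ∀ k α, π (u k α) * defect ε π b * π (v α k) ∈ nuclear H H := fun k α =>
    mem_nuclear_comp (comp_mem_nuclear (π (u k α)) hb) (π (v α k))
  have hnuc' : ∀ k α, defect ε π b * π (v α k * u k α) ∈ nuclear H H := fun k α =>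
    mem_nuclear_comp hb _
  -- Cyclicity moves `π(u)` behind `π(v)`, where the sum collapses to `π(Tr (v u)) = r`.
  have htr : ntr (∑ k, ∑ α, π (u k α) * defect ε π b * π (v α k)) = r * ntr (defect ε π b) := by
    have h2 : ∀ k α, ntr (π (u k α) * defect ε π b * π (v α k)) =
        ntr (defect ε π b * π (v α k * u k α)) := by
      intro k α
      rw [mul_assoc, map_mul, ← mul_assoc (defect ε π b)]
      exact ntr_comp_comm (mem_nuclear_comp hb (π (v α k))) (π (u k α))
    rw [ntr_sum _ _ fun k => Submodule.sum_mem _ fun α _ => hnuc k α]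
    have h3 : ∀ k, ntr (∑ α, π (u k α) * defect ε π b * π (v α k)) =
        ntr (∑ α, defect ε π b * π (v α k * u k α)) := by
      intro k
      rw [ntr_sum _ _ fun α => hnuc k α, ntr_sum _ _ fun α => hnuc' k α]
      exact Finset.sum_congr rfl fun α _ => h2 k α
    simp only [h3]
    rw [← ntr_sum _ _ fun k => Submodule.sum_mem _ fun α _ => hnuc' k α]
    simp only [← Finset.mul_sum, ← map_sum]
    rw [hsum, map_natCast, ← ntr_smul _ hb]
    congr 1
    ext x
    simp [Nat.cast_smul_eq_nsmul]
  rw [hdec, ntr_add (Submodule.sum_mem _ fun k _ => Submodule.sum_mem _ fun α _ => hnuc k α)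
    (Submodule.smul_mem _ _ h1), htr, ntr_smul _ h1, add_comm]

theorem trace_submatrix_symm {R J K : Type*} [Ring R] [Fintype J] [Fintype K] (e : J ≃ K)
    (p : Matrix J J R) : (p.submatrix e.symm e.symm).trace = p.trace :=
  Equiv.sum_comp e.symm fun j => p j j

theorem K0_mk_map_eq {R S : Type*} [Ring R] [Ring S] (f : R →+* S) {E : Type*} [AddCommGroup E]
    [Module Rᵐᵒᵖ E] {m n : ℕ} {p : Matrix (Fin m) (Fin m) R} {q : Matrix (Fin n) (Fin n) R}
    (hp : Represents E p) (hq : Represents E q) :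
    K0.mk (p.map f) (isIdempotentElem_map f hp.isIdempotentElem) =
      K0.mk (q.map f) (isIdempotentElem_map f hq.isIdempotentElem) := by
  obtain ⟨x, y, h1, h2⟩ := hp.exists_mul_eq hq
  refine K0.mk_eq_of_equivalent (p := ⟨m, p.map f, isIdempotentElem_map f hp.isIdempotentElem⟩)
    (q := ⟨n, q.map f, isIdempotentElem_map f hq.isIdempotentElem⟩)
    ⟨x.map f, y.map f, ?_, ?_⟩
  · change p.map f = _
    rw [← Matrix.map_mul, ← h1]
  · change q.map f = _
    rw [← Matrix.map_mul, ← h2]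

theorem IsVect.exists_represents {R S E : Type*} [Ring R] [Ring S] [Module R S]
    [SMulCommClass R Sᵐᵒᵖ S] [AddCommGroup E] [Module R E] [Module Rᵐᵒᵖ E]
    [SMulCommClass R Rᵐᵒᵖ E] (hE : IsVect R S E) :
    ∃ (n : ℕ) (p : Matrix (Fin n) (Fin n) R), Represents E p := by
  have := hE.finite
  have := hE.projective
  exact NCBundle.exists_represents

/-- The class in `K_0` of an object of `Vect`, pushed forward along a ring homomorphism. -/
def VectObj.K0Class {R S : Type u} [Ring R] [Ring S] [Module R S] [SMulCommClass R Sᵐᵒᵖ S]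
    {T : Type*} [Ring T] (f : R →+* T) (E : VectObj R S) : K0 T :=
  K0.mk (E.2.exists_represents.choose_spec.choose.map f)
    (isIdempotentElem_map f E.2.exists_represents.choose_spec.choose_spec.isIdempotentElem)

theorem VectObj.K0Class_eq {R S : Type u} [Ring R] [Ring S] [Module R S]
    [SMulCommClass R Sᵐᵒᵖ S] {T : Type*} [Ring T] (f : R →+* T) (E : VectObj R S) {n : ℕ}
    {p : Matrix (Fin n) (Fin n) R} (hp : Represents E.1.carrier p) :
    E.K0Class f = K0.mk (p.map f) (isIdempotentElem_map f hp.isIdempotentElem) :=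
  K0_mk_map_eq f E.2.exists_represents.choose_spec.choose_spec hp

/-- The semiring homomorphism given by the Chern character. -/
theorem exists_chern {ι : B →⋆ₐ[ℂ] C} (hπ : ∀ b : B, defect ε π b ∈ nuclear H H)
    (chK : K0 C →+ DualNumber ℤ)
    (hchK : ∀ (N : ℕ) (p : Matrix (Fin N) (Fin N) B) (hp : IsIdempotentElem p),
        ((chK (K0.mk (p.map ι) (isIdempotentElem_map (ι : B →+* C) hp))).fst : ℂ) =
            ε (p.trace : A) ∧
          ((chK (K0.mk (p.map ι) (isIdempotentElem_map (ι : B →+* C) hp))).snd : ℂ) =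
            ntr (defect ε π (p.trace : A))) :
    ∃ ch : Vect B A →+* DualNumber ℤ,
      ∀ (E : Type u) [AddCommGroup E] [Module B E] [Module Bᵐᵒᵖ E] [SMulCommClass B Bᵐᵒᵖ E]
        (hE : IsVect B A E) (N : ℕ) (p : Matrix (Fin N) (Fin N) B) (hp : Represents E p),
        ch (Vect.mk A E hE) = chK (K0.mk (p.map ι)
          (isIdempotentElem_map (ι : B →+* C) hp.isIdempotentElem)) := by
  let f : VectObj B A → DualNumber ℤ := fun E => chK (E.K0Class (ι : B →+* C))
  have hf : ∀ (E : VectObj B A) {n : ℕ} {p : Matrix (Fin n) (Fin n) B}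
      (hp : Represents E.1.carrier p), f E = chK (K0.mk (p.map ι)
        (isIdempotentElem_map (ι : B →+* C) hp.isIdempotentElem)) := fun E n p hp =>
    congrArg chK (E.K0Class_eq (ι : B →+* C) hp)
  -- Arbitrary finite index types are allowed because direct sums and tensor products are
  -- represented over `I ⊕ J` and `J × K`.
  have hval : ∀ (E : VectObj B A) {J : Type} [Fintype J] [DecidableEq J] {p : Matrix J J B},
      Represents E.1.carrier p → ((f E).fst : ℂ) = ε (p.trace : A) ∧
        ((f E).snd : ℂ) = ntr (defect ε π (p.trace : A)) := by
    intro E J _ _ p hp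
    have hp' := hp.reindex (Fintype.equivFin J)
    have := hchK _ _ hp'.isIdempotentElem
    rwa [trace_submatrix_symm, ← hf E hp'] at this
  have hext : ∀ {x y : DualNumber ℤ}, (x.fst : ℂ) = y.fst → (x.snd : ℂ) = y.snd → x = y :=
    fun h1 h2 => TrivSqZeroExt.ext (by exact_mod_cast h1) (by exact_mod_cast h2)
  let F : Vect B A → DualNumber ℤ := Quotient.lift f (by
    rintro E E' ⟨e⟩
    obtain ⟨n, p, hp⟩ := E.2.exists_represents
    rw [hf E hp, hf E' (hp.of_equiv e.toRight)])
  have hF0 : F 0 = 0 := by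
    have h := hval ⟨⟨PUnit.{u + 1}⟩, IsVect.zero B A⟩ (represents_punit (R := B))
    refine hext (h.1.trans ?_) (h.2.trans ?_)
    · simp
    · simp [defect_zero, ntr_zero]
  have hF1 : F 1 = 1 := by
    have h := hval ⟨⟨B⟩, IsVect.one B A⟩ (represents_self (R := B))
    refine hext (h.1.trans ?_) (h.2.trans ?_)
    · simp
    · simp [defect_one, ntr_zero]
  have hFadd : ∀ x y, F (x + y) = F x + F y := by
    intro x y
    induction x using Vect.ind with | h E
    induction y using Vect.ind with | h E'
    obtain ⟨m, p, hp⟩ := E.2.exists_represents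
    obtain ⟨n, q, hq⟩ := E'.2.exists_represents
    have h := hval ⟨⟨E.1.carrier × E'.1.carrier⟩, E.2.prod E'.2⟩ (hp.prod hq)
    have hE := hval E hp
    have hE' := hval E' hq
    have htr : ((Matrix.fromBlocks p 0 0 q).trace : A) = (p.trace : A) + (q.trace : A) := by
      rw [← AddMemClass.coe_add]
      simp [Matrix.trace]
    rw [htr] at h
    change f _ = f E + f E'
    refine hext (h.1.trans ?_) (h.2.trans ?_)
    · rw [TrivSqZeroExt.fst_add, Int.cast_add, hE.1, hE'.1, map_add]
    · rw [TrivSqZeroExt.snd_add, Int.cast_add, hE.2, hE'.2, defect_add, ntr_add (hπ _) (hπ _)]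
  have hFmul : ∀ x y, F (x * y) = F x * F y := by
    intro x y
    induction x using Vect.ind with | h E
    induction y using Vect.ind with | h E'
    obtain ⟨m, p, hp⟩ := E.2.exists_represents
    obtain ⟨n, q, hq⟩ := E'.2.exists_represents
    have hE := hval E hp
    have hE' := hval E' hq
    obtain ⟨η, ζ, hζη, rfl⟩ := hq
    have h := hval ⟨⟨BalTensor B E.1.carrier E'.1.carrier⟩, E.2.tensor E'.2⟩ (hp.tensor η ζ hζη)
    rw [trace_tensor] at h
    -- Trivializing the right-hand factor is what gives the action matrix the form `u b v` over `A`.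
    obtain ⟨r, ⟨Θ⟩⟩ := E'.2.trivializes
    obtain ⟨u, v, hvu, huv⟩ := exists_matrices_of_trivializes B Θ η ζ hζη
    have htr : ∀ b : B, ((actionMatrix η ζ b).trace : A) = ∑ k, ∑ α, u k α * b * v α k := by
      intro b
      rw [← Finset.sum_congr rfl fun k _ => huv b k k]
      simp [Matrix.trace]
    have htr1 : ((rightMatrix (η ∘ₗ ζ)).trace : A) = ∑ k, ∑ α, u k α * v α k := by
      rw [← actionMatrix_one, htr]
      simp
    have key := trace_defect_conj hvu (hπ p.trace) (by rw [← htr1]; exact hπ _)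
    -- The case `b = 1` identifies `r` with the degree zero part of the character of `E'`.
    have key1 := (trace_defect_conj (ε := ε) (π := π) hvu (b := 1)
      (by rw [defect_one]; exact zero_mem _) (by rw [← htr1]; exact hπ _)).1
    simp only [mul_one, map_one, one_mul] at key1
    rw [← htr1] at key key1
    rw [htr] at h
    change f _ = f E * f E'
    refine hext (h.1.trans ?_) (h.2.trans ?_)
    · rw [TrivSqZeroExt.fst_mul, Int.cast_mul, hE.1, hE'.1, key.1, key1]
    · rw [TrivSqZeroExt.snd_mul, smul_eq_mul, MulOpposite.smul_eq_mul_unop, Int.cast_add,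
        Int.cast_mul, Int.cast_mul, hE.1, hE'.2, hE.2, unop_op, hE'.1, key.2, key1,
        mul_comm (r : ℂ)]
  exact ⟨{ toFun := F, map_one' := hF1, map_mul' := hFmul, map_zero' := hF0, map_add' := hFadd },
    fun E _ _ _ _ hE N p hp => hf ⟨⟨E⟩, hE⟩ hp⟩

/-- The idempotent `ψ ξ` is left multiplication by `u v`. Cyclicity of the matrix trace fails over
`A`, so `ε` is applied first: over `ℂ` the trace of `ε(u) ε(v)` is that of `ε(v u) = 1`, namely `r`.
-/
theorem IsTrivializingPair.represents {E : Type*} [AddCommGroup E] [Module Bᵐᵒᵖ E] {N r : ℕ}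
    {u : Matrix (Fin N) (Fin r) A} {v : Matrix (Fin r) (Fin N) A}
    (h : IsTrivializingPair B E u v) :
    ∃ p : Matrix (Fin N) (Fin N) B, Represents E p ∧ ε (p.trace : A) = r := by
  obtain ⟨hvu, -, Θ, ψ, ξ, hξψ, hψ, hξ⟩ := h
  refine ⟨rightMatrix (ψ ∘ₗ ξ), ⟨ψ, ξ, hξψ, rfl⟩, ?_⟩
  have hp : ∀ i j, ((rightMatrix (ψ ∘ₗ ξ) i j : B) : A) = (u * v) i j := by
    intro i j
    have h1 := congrFun (hψ (ξ (Pi.single j 1))) i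
    have h2 : (fun i => (((Pi.single j 1 : Fin N → B) i : B) : A)) = Pi.single j 1 := by
      funext k
      by_cases hk : k = j
      · subst hk; simp
      · simp [hk]
    rw [hξ, Matrix.mulVec_mulVec, h2, Matrix.mulVec_single_one] at h1
    exact h1
  have h3 : ((rightMatrix (ψ ∘ₗ ξ)).trace : A) = (u * v).trace := by
    simp [Matrix.trace, hp]
  have h4 : ∀ {m : ℕ} (M : Matrix (Fin m) (Fin m) A), ε M.trace = (M.map ε).trace := fun M =>
    AddMonoidHom.map_trace ε M
  rw [h3, h4, Matrix.map_mul, Matrix.trace_mul_comm, ← Matrix.map_mul, hvu, ← h4,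
    Matrix.trace_one, map_natCast, Fintype.card_fin]

end Chern

end NCBundle

end

theorem proposition3p5
    {A : Type u} [Ring A] [StarRing A] [Algebra ℂ A] [StarModule ℂ A]
    (B : StarSubalgebra ℂ A)
    {C : Type v} [CStarAlgebra C] (ι : B →⋆ₐ[ℂ] C) (hι : IsCStarEnvelope ι)
    {H : Type w} [NormedAddCommGroup H] [InnerProductSpace ℂ H] [CompleteSpace H]
    (ε : A →⋆ₐ[ℂ] ℂ) (π : A →⋆ₐ[ℂ] (H →L[ℂ] H))
    (hπ : ∀ b ∈ B, IsTraceClass (π b - ε b • (1 : H →L[ℂ] H))) :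
    ∃ (ch : Vect B A →+* DualNumber ℤ) (chK : K0 C →+ DualNumber ℤ),
      (∀ (N : ℕ) (p : Matrix (Fin N) (Fin N) B) (hp : IsIdempotentElem p),
        ((chK (K0.mk (p.map ι) (isIdempotentElem_map (ι : B →+* C) hp))).fst : ℂ) =
            ε (p.trace : A) ∧
        HasTrace (π (p.trace : A) - ε (p.trace : A) • (1 : H →L[ℂ] H))
          ((chK (K0.mk (p.map ι) (isIdempotentElem_map (ι : B →+* C) hp))).snd : ℂ)) ∧
      (∀ (E : Type u) [AddCommGroup E] [Module B E] [Module Bᵐᵒᵖ E] [SMulCommClass B Bᵐᵒᵖ E]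
        (hE : IsVect B A E) (N : ℕ) (p : Matrix (Fin N) (Fin N) B) (hp : IsIdempotentElem p),
        Nonempty (E ≃ₗ[Bᵐᵒᵖ] idemModule p) →
          ((ch (Vect.mk A E hE)).fst : ℂ) = ε (p.trace : A) ∧
          HasTrace (π (p.trace : A) - ε (p.trace : A) • (1 : H →L[ℂ] H))
            ((ch (Vect.mk A E hE)).snd : ℂ) ∧
          chK (K0.mk (p.map ι) (isIdempotentElem_map (ι : B →+* C) hp)) =
            ch (Vect.mk A E hE)) ∧
      (∀ (E : Type u) [AddCommGroup E] [Module B E] [Module Bᵐᵒᵖ E] [SMulCommClass B Bᵐᵒᵖ E]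
        (hE : IsVect B A E) (N r : ℕ) (u : Matrix (Fin N) (Fin r) A)
        (v : Matrix (Fin r) (Fin N) A), IsTrivializingPair B E u v →
          (ch (Vect.mk A E hE)).fst = r) := by
  have hnuc : ∀ b : B, defect ε π b ∈ nuclear H H := fun b => (hπ b b.2).mem_nuclear
  obtain ⟨chK, hchK⟩ := exists_K0_chern hι hnuc
  -- `ch` is `chK` evaluated at the class of a representing idempotent, so compatibility of the two
  -- holds by construction.
  obtain ⟨ch, hch⟩ := exists_chern hnuc chK hchK
  refine ⟨ch, chK, fun N p hp => ⟨(hchK N p hp).1, ?_⟩, ?_, ?_⟩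
  · rw [(hchK N p hp).2]
    exact hasTrace_ntr (hnuc p.trace)
  · rintro E _ _ _ _ hE N p hp ⟨e⟩
    rw [hch E hE N p (represents_of_equiv_idemModule hp e), (hchK N p hp).2]
    exact ⟨(hchK N p hp).1, hasTrace_ntr (hnuc p.trace), rfl⟩
  · intro E _ _ _ _ hE N r u v huv
    obtain ⟨p, hp, hr⟩ := IsTrivializingPair.represents (ε := ε) huv
    have h := (hchK N p hp.isIdempotentElem).1
    rw [hr] at h
    rw [hch E hE N p hp]
    exact_mod_cast h
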